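/- **$q$-rationals.** For $n\in\mathbb Z$ put $\{n\}=\frac{q^{2n}-1}{q^2-1}$ and $\{n\}_{q^{-2}}=\frac{q^{-2n}-1}{q^{-2}-1}$ in $\mathbb Q(q)$. For $x\in\mathbb Q$ with continued fraction expansion $[a_1,\dots,a_n]$ of even length ($a_1\in\mathbb Z$, $a_2,\dots,a_n\ge 1$) put $$\{x\}=\{a_1\}+\cfrac{q^{2a_1}}{\{a_2\}_{q^{-2}}+\cfrac{q^{-2a_2}}{\{a_3\}+\cfrac{q^{2a_3}}{\ddots+\cfrac{q^{2a_{n-1}}}{\{a_n\}_{q^{-2}}}}}},\qquad \binom{x}{k}_q=\frac{\{x\}\{x-1\}\cdots\{x-k+1\}}{\{k\}\{k-1\}\cdots\{1\}},\qquad \delta_x=\{x\}-\{x-1\}.$$ **Webs.** Let $R$ be a commutative $\mathbb Q(q)$-algebra and $a\in R^\times$. The web category over $(R,a)$ is the $R$-linear pivotal monoidal category whose objects are words in upward and downward arrows labelled by positive integers and whose morphisms are $R$-linear combinations of oriented labelled trivalent planar graphs (generated by the vertices $k\otimes l\to k+l$ and $k+l\to k\otimes l$, cups and caps), up to planar isotopy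 and the following relations (edges labelled $0$ are erased, webs with an edge of negative label are zero): associativity and coassociativity of the vertices; the digon $k+l\to k\otimes l\to k+l$ equals $q^{-kl}\binom{k+l}{k}_q$; with $F^{(b)}$, $E^{(b)}$ denoting the ladders with one rung labelled $b$ directed to the right, respectively to the left, $EF-FE=q^{1-k+l}\{k-l\}$ on uprights $k,l$, and the cubic Serre relations between ladders on three uprights; a circle labelled $1$ equals $\frac{a-a^{-1}}{q-q^{-1}}$ in both orientations; closing one strand (on the right or on the left) of the web $1\otimes1\to2\to1\otimes1$ gives $\frac{aq^{-1}-a^{-1}q}{q-q^{-1}}$ times the identity; and the mixed square of edges $1,2,1,2$ equals the identity plus $\frac{aq^{-2}-a^{-1}q^2}{q-q^{-1}}$ times the cap followed by the cup, together with the mirror image. A crossing of upward strands labelled $k$ (starting bottom left) and $l$ (starting bottom right) is sent to $$(-q)^{kl}\sum_{\substack{b,c\ge0\\ b-c=k-l}}(-q)^{b-k}E^{(c)}F^{(b)}\quad\text{if the strand labelled }k\text{ is over},\qquad (-q)^{-kl}\sum_{\substack{b,c\ge0\\ b-c=l-k}}(-q)^{l-b}F^{(c)}E^{(b)}\quad\text{if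 it is under.}$$ Thus a coloured link diagram has a value in $\mathrm{End}(\emptyset)$. For $R=\mathbb Q(q)[a^{\pm1}]$ this value, a multiple of the identity, is its (framed, coloured) HOMFLY-PT polynomial. For $x\in\mathbb Q$ and an element $\nu_x$ of a commutative $\mathbb Q(q)$-algebra $R$ with $\nu_x^2=\delta_x^{-1}$ (for instance $R=\mathbb Q(q)[\nu_x]$), the $x$-invariant $[D]_x\in R$ is the specialization of the HOMFLY-PT polynomial of $D$ at $a=q\nu_x\delta_x$; equivalently it is the scalar by which $D$ acts in the web category over $(R,q\nu_x\delta_x)$. **Statement.** For $k\ge1$ let $U_k$ be the once stabilized unknot coloured by $k$: the figure-eight diagram with one crossing, whose two strands both point upwards at the crossing, with the strand from bottom right to top left over, the left ends being joined around the left and the right ends around the right. Then for every $x\in\mathbb Q$ $$[U_1]_x=\{x\},\qquad\text{and more generally}\qquad [U_k]_x=q^{-k(k-1)}\binom{x}{k}_q\quad\text{for all }k\ge1 .$$ -/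

import Mathlib

open CategoryTheory MonoidalCategory
open scoped LaurentPolynomial

universe u

namespace QWeb

noncomputable section

/-! ### `q`-integers and `q`-rationals

The ground field is `ℚ(q)`; the variable of the usual `q`-rationals is `q ^ 2` here. -/

/-- The field of rational fractions `ℚ(q) = Frac ℤ[q]`. -/
abbrev Kq : Type := RatFunc ℚ

/-- The indeterminate `q`. -/
def q : Kq := RatFunc.X

/-- `{n} = (q^{2n} - 1) / (q^2 - 1)` for `n ∈ ℤ`. -/
def qInt (n : ℤ) : Kq := (q ^ (2 * n) - 1) / (q ^ 2 - 1)

/-- `{n}_{q^{-2}} = (q^{-2n} - 1) / (q^{-2} - 1)`, i.e. `{n}` with `q` replaced by `q⁻¹`. -/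
def qIntInv (n : ℤ) : Kq := (q ^ (-2 * n) - 1) / (q ^ (-2 : ℤ) - 1)

/-- The integral `q`-binomial coefficient
`{n choose k} = {n}{n-1}⋯{n-k+1} / ({k}{k-1}⋯{1})`. -/
def qIntBinom (n : ℤ) (k : ℕ) : Kq :=
  (∏ i ∈ Finset.range k, qInt (n - i)) / ∏ i ∈ Finset.range k, qInt (i + 1)

theorem evenCF_decreasing (x : ℚ) (h : (x - ((⌈x⌉ - 1 : ℤ) : ℚ))⁻¹ ≠
    (⌊(x - ((⌈x⌉ - 1 : ℤ) : ℚ))⁻¹⌋ : ℚ)) :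
    (((x - ((⌈x⌉ - 1 : ℤ) : ℚ))⁻¹ - (⌊(x - ((⌈x⌉ - 1 : ℤ) : ℚ))⁻¹⌋ : ℚ))⁻¹).den < x.den := by
  set r : ℚ := x - ((⌈x⌉ - 1 : ℤ) : ℚ) with hr
  have hr0 : 0 < r := by
    have := Int.ceil_lt_add_one x
    rw [hr]; push_cast; linarith
  have hr1 : r ≤ 1 := by
    have := Int.le_ceil x
    rw [hr]; push_cast; linarith
  have hden : r.den = x.den := by
    rw [hr]; exact Rat.sub_intCast_den x _
  have hf : r⁻¹ - (⌊r⁻¹⌋ : ℚ) = Int.fract r⁻¹ := rfl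
  have hne : Int.fract r⁻¹ ≠ 0 := by
    rw [← hf]; exact sub_ne_zero.mpr h
  have hlt := Rat.fract_inv_num_lt_num_of_pos hr0
  have hle : r.num ≤ r.den := Rat.num_le_denom_iff.mpr hr1
  have hpos : 0 < (Int.fract r⁻¹).num :=
    Rat.num_pos.mpr (lt_of_le_of_ne (Int.fract_nonneg _) hne.symm)
  rw [hf, Rat.den_inv_of_ne_zero hne, ← hden]
  omega

/-- The continued fraction expansion `[a₁, a₂, …, aₙ]` of `x` of even length `n`, with
`a₁ ∈ ℤ` and `a₂, …, aₙ ≥ 1` (see `evenCF_spec`). -/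
def evenCF (x : ℚ) : List ℤ :=
  let a : ℤ := ⌈x⌉ - 1
  let y : ℚ := (x - a)⁻¹
  if _h : y = ⌊y⌋ then [a, ⌊y⌋] else a :: ⌊y⌋ :: evenCF (y - ⌊y⌋)⁻¹
termination_by x.den
decreasing_by exact evenCF_decreasing x _h

/-- The value `a₁ + 1 / (a₂ + 1 / (a₃ + ⋯))` of a finite continued fraction. -/
def cfValue : List ℤ → ℚ
  | [] => 0
  | [a] => a
  | a :: b :: l => a + 1 / cfValue (b :: l)

theorem evenCF_ne_nil (x : ℚ) : evenCF x ≠ [] := by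
  rw [evenCF]; split <;> simp

theorem evenCF_spec (x : ℚ) :
    Even (evenCF x).length ∧ (∀ b ∈ (evenCF x).tail, 1 ≤ b) ∧ cfValue (evenCF x) = x ∧
      (1 < x → ∀ b ∈ evenCF x, 1 ≤ b) := by
  induction hn : x.den using Nat.strong_induction_on generalizing x with
  | _ n ih =>
  have hr0 : (0 : ℚ) < x - ((⌈x⌉ - 1 : ℤ) : ℚ) := by
    have := Int.ceil_lt_add_one x
    push_cast; linarith
  have hr1 : x - ((⌈x⌉ - 1 : ℤ) : ℚ) ≤ 1 := by
    have := Int.le_ceil x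
    push_cast; linarith
  have hy1 : (1 : ℚ) ≤ (x - ((⌈x⌉ - 1 : ℤ) : ℚ))⁻¹ := (one_le_inv₀ hr0).mpr hr1
  have hb : (1 : ℤ) ≤ ⌊(x - ((⌈x⌉ - 1 : ℤ) : ℚ))⁻¹⌋ := Int.le_floor.mpr (by simpa using hy1)
  have ha : 1 < x → (1 : ℤ) ≤ ⌈x⌉ - 1 := fun h => by
    have : (1 : ℤ) < ⌈x⌉ := Int.lt_ceil.mpr (by simpa using h)
    omega
  rw [evenCF]
  split_ifs with h
  · refine ⟨by simp, by simpa using hb, ?_, fun hx b hb' => by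
      simp only [List.mem_cons, List.not_mem_nil, or_false] at hb'
      rcases hb' with rfl | rfl
      · exact ha hx
      · exact hb⟩
    simp only [cfValue]
    rw [← h]; simp
  · set y : ℚ := (x - ((⌈x⌉ - 1 : ℤ) : ℚ))⁻¹ with hy
    have hlt := evenCF_decreasing x h
    obtain ⟨h1, -, h3, h4⟩ := ih _ (hn ▸ hlt) (y - ⌊y⌋)⁻¹ rfl
    have hf0 : 0 < y - ⌊y⌋ :=
      lt_of_le_of_ne (Int.fract_nonneg y) (sub_ne_zero.mpr h).symm
    have hf1 : y - ⌊y⌋ < 1 := Int.fract_lt_one y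
    have hgt : 1 < (y - ⌊y⌋)⁻¹ := (one_lt_inv₀ hf0).mpr hf1
    have h5 := h4 hgt
    refine ⟨by simpa [Nat.even_add_one] using h1, ?_, ?_, ?_⟩
    · intro b hb'
      simp only [List.tail_cons, List.mem_cons] at hb'
      rcases hb' with rfl | hb'
      · exact hb
      · exact h5 b hb'
    · obtain ⟨c, l, hcl⟩ := List.exists_cons_of_ne_nil (evenCF_ne_nil (y - ⌊y⌋)⁻¹)
      rw [hcl] at h3 ⊢
      simp only [cfValue]
      rw [h3, one_div, one_div, inv_inv, add_sub_cancel, hy, inv_inv]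
      ring
    · intro hx b hb'
      simp only [List.mem_cons] at hb'
      rcases hb' with rfl | rfl | hb'
      · exact ha hx
      · exact hb
      · exact h5 b hb'

/-- The `q`-deformed continued fraction
`{a₁} + q^{2a₁} / ({a₂}_{q⁻²} + q^{-2a₂} / ({a₃} + q^{2a₃} / (⋱ + q^{2aₙ₋₁} / {aₙ}_{q⁻²})))`. -/
def qCF : List ℤ → Kq
  | [] => 0
  | [a] => qInt a
  | [a, b] => qInt a + q ^ (2 * a) / qIntInv b
  | a :: b :: c :: l => qInt a + q ^ (2 * a) / (qIntInv b + q ^ (-2 * b) / qCF (c :: l))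

/-- The `q`-rational `{x}` of Morier-Genoud and Ovsienko (in the variable `q ^ 2`). -/
def qRat (x : ℚ) : Kq := qCF (evenCF x)

/-- `{x choose k} = {x}{x-1}⋯{x-k+1} / ({k}{k-1}⋯{1})` for `x ∈ ℚ`. -/
def qBinom (x : ℚ) (k : ℕ) : Kq :=
  (∏ i ∈ Finset.range k, qRat (x - i)) / ∏ i ∈ Finset.range k, qInt (i + 1)

/-- `δ_x = {x} - {x - 1}`. -/
def qDelta (x : ℚ) : Kq := qRat x - qRat (x - 1)

/-! `δ_x` is invertible: `{x}` has no pole at `q = 1` and takes the value `x` there. -/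

/-- The fraction `f` has no pole at `q = 1`, where its value is `v`. -/
def HasValue (f : Kq) (v : ℚ) : Prop :=
  ∃ p r : Polynomial ℚ, r.eval 1 ≠ 0 ∧ p.eval 1 = v * r.eval 1 ∧
    f * algebraMap (Polynomial ℚ) Kq r = algebraMap (Polynomial ℚ) Kq p

theorem HasValue.map_ne_zero {r : Polynomial ℚ} (h : r.eval 1 ≠ 0) :
    algebraMap (Polynomial ℚ) Kq r ≠ 0 := by
  intro h0
  have : r = 0 := (FaithfulSMul.algebraMap_injective (Polynomial ℚ) Kq) (by rw [h0, map_zero])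
  simp [this] at h

theorem HasValue.add {f g : Kq} {v w : ℚ} (hf : HasValue f v) (hg : HasValue g w) :
    HasValue (f + g) (v + w) := by
  obtain ⟨p, r, hr, hp, h⟩ := hf
  obtain ⟨p', r', hr', hp', h'⟩ := hg
  refine ⟨p * r' + p' * r, r * r', by simp [hr, hr'], ?_, ?_⟩
  · simp only [Polynomial.eval_add, Polynomial.eval_mul, hp, hp']; ring
  · simp only [map_add, map_mul, ← h, ← h']; ring

theorem HasValue.mul {f g : Kq} {v w : ℚ} (hf : HasValue f v) (hg : HasValue g w) :
    HasValue (f * g) (v * w) := by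
  obtain ⟨p, r, hr, hp, h⟩ := hf
  obtain ⟨p', r', hr', hp', h'⟩ := hg
  refine ⟨p * p', r * r', by simp [hr, hr'], ?_, ?_⟩
  · simp only [Polynomial.eval_mul, hp, hp']; ring
  · simp only [map_mul, ← h, ← h']; ring

theorem HasValue.inv {f : Kq} {v : ℚ} (hf : HasValue f v) (hv : v ≠ 0) :
    HasValue f⁻¹ v⁻¹ := by
  obtain ⟨p, r, hr, hp, h⟩ := hf
  have hp0 : p.eval 1 ≠ 0 := by rw [hp]; exact mul_ne_zero hv hr
  have hf0 : f ≠ 0 := by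
    rintro rfl
    rw [zero_mul] at h
    exact HasValue.map_ne_zero hp0 h.symm
  refine ⟨r, p, hp0, ?_, ?_⟩
  · rw [hp, inv_mul_cancel_left₀ hv]
  · rw [← h, inv_mul_cancel_left₀ hf0]

theorem HasValue.div {f g : Kq} {v w : ℚ} (hf : HasValue f v) (hg : HasValue g w)
    (hw : w ≠ 0) : HasValue (f / g) (v / w) := by
  rw [div_eq_mul_inv, div_eq_mul_inv]; exact hf.mul (hg.inv hw)

theorem HasValue.ne_zero {f : Kq} {v : ℚ} (hf : HasValue f v) (hv : v ≠ 0) : f ≠ 0 := by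
  obtain ⟨p, r, hr, hp, h⟩ := hf
  rintro rfl
  rw [zero_mul] at h
  exact HasValue.map_ne_zero (by rw [hp]; exact mul_ne_zero hv hr) h.symm

theorem hasValue_one : HasValue 1 1 := ⟨1, 1, by simp, by simp, by simp⟩

theorem hasValue_neg_one : HasValue (-1) (-1) := ⟨-1, 1, by simp, by simp, by simp⟩

theorem hasValue_q : HasValue q 1 := ⟨Polynomial.X, 1, by simp, by simp, by simp [q]⟩

theorem hasValue_q_pow (n : ℕ) : HasValue (q ^ n) 1 := by
  induction n with
  | zero => simpa using hasValue_one
  | succ n ih => simpa [pow_succ] using ih.mul hasValue_q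

theorem hasValue_q_zpow (n : ℤ) : HasValue (q ^ n) 1 := by
  obtain ⟨m, rfl | rfl⟩ := n.eq_nat_or_neg
  · simpa using hasValue_q_pow m
  · simpa using (hasValue_q_pow m).inv one_ne_zero

theorem q_ne_zero : q ≠ 0 := RatFunc.X_ne_zero

theorem q_pow_ne_one {n : ℕ} (hn : n ≠ 0) : q ^ n ≠ 1 := by
  intro h
  have h2 : (Polynomial.X ^ n : Polynomial ℚ) = 1 :=
    (FaithfulSMul.algebraMap_injective (Polynomial ℚ) Kq) (by
      simpa [q, RatFunc.algebraMap_X] using h)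
  have := congrArg Polynomial.natDegree h2
  simp at this
  exact hn this

theorem q_sub_inv_ne_zero : q - q⁻¹ ≠ 0 := by
  intro h
  apply q_pow_ne_one two_ne_zero
  have h' := sub_eq_zero.mp h
  rw [pow_two]
  nth_rewrite 2 [h']
  exact mul_inv_cancel₀ q_ne_zero

theorem hasValue_geom (z : Kq) (hz : ∀ n : ℤ, HasValue (z ^ n) 1) (h0 : z ≠ 0) (h1 : z ≠ 1)
    (n : ℤ) : HasValue ((z ^ n - 1) / (z - 1)) n := by
  have h1' : z - 1 ≠ 0 := sub_ne_zero.mpr h1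
  have key : ∀ m : ℕ, HasValue ((z ^ m - 1) / (z - 1)) m := by
    intro m
    induction m with
    | zero => exact ⟨0, 1, by simp, by simp, by simp⟩
    | succ m ih =>
      have e : (z ^ (m + 1) - 1) / (z - 1) = (z ^ m - 1) / (z - 1) + z ^ m := by
        field_simp; ring
      rw [e]
      push_cast
      exact ih.add (by simpa using hz m)
  obtain ⟨m, rfl | rfl⟩ := n.eq_nat_or_neg
  · simpa using key m
  · have e : (z ^ (-(m : ℤ)) - 1) / (z - 1) =
        (-1) * (z ^ (-(m : ℤ)) * ((z ^ m - 1) / (z - 1))) := by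
      rw [zpow_neg, zpow_natCast]
      have := pow_ne_zero m h0
      field_simp; ring
    rw [e]
    have := hasValue_neg_one.mul ((hz (-(m : ℤ))).mul (key m))
    simpa using this

theorem hasValue_qInt (n : ℤ) : HasValue (qInt n) n := by
  have h := hasValue_geom (q ^ 2) (fun n => by
    have := hasValue_q_zpow (2 * n)
    rwa [zpow_mul] at this) (pow_ne_zero _ q_ne_zero) (q_pow_ne_one two_ne_zero) n
  rw [qInt, zpow_mul]; exact h

theorem hasValue_qIntInv (n : ℤ) : HasValue (qIntInv n) n := by
  have h := hasValue_geom (q ^ (-2 : ℤ)) (fun n => by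
    have := hasValue_q_zpow (-2 * n)
    rwa [zpow_mul] at this) (zpow_ne_zero _ q_ne_zero) (by
      rw [zpow_neg, ne_eq, inv_eq_one]
      exact q_pow_ne_one two_ne_zero) n
  rw [qIntInv, zpow_mul]; exact h

theorem cfValue_pos (l : List ℤ) (hl : l ≠ []) (h : ∀ b ∈ l, 1 ≤ b) : 0 < cfValue l := by
  induction l using cfValue.induct with
  | case1 => exact absurd rfl hl
  | case2 a =>
    have : 1 ≤ a := h a (by simp)
    simp only [cfValue]; exact_mod_cast (by omega : 0 < a)
  | case3 a b l ih =>
    have h1 : (1 : ℤ) ≤ a := h a (by simp)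
    have h2 := ih (by simp) (fun c hc => h c (by simp [hc]))
    have h3 : (0 : ℚ) < a := by exact_mod_cast (by omega : 0 < a)
    simp only [cfValue]; positivity

theorem hasValue_qCF (l : List ℤ) (h : ∀ b ∈ l.tail, 1 ≤ b) :
    HasValue (qCF l) (cfValue l) := by
  induction l using qCF.induct with
  | case1 => exact ⟨0, 1, by simp, by simp [cfValue], by simp [qCF]⟩
  | case2 a => simpa [qCF, cfValue] using hasValue_qInt a
  | case3 a b =>
    have hb : 1 ≤ b := h b (by simp)
    simp only [qCF, cfValue]
    exact (hasValue_qInt a).add ((hasValue_q_zpow _).div (hasValue_qIntInv b)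
      (by exact_mod_cast (by omega : b ≠ 0)))
  | case4 a b c l ih =>
    have h2 : ∀ d ∈ c :: l, 1 ≤ d := fun d hd => h d (by
      simp only [List.tail_cons]; exact List.mem_cons_of_mem _ hd)
    have p1 := cfValue_pos (c :: l) (by simp) h2
    have p2 := cfValue_pos (b :: c :: l) (by simp) (by simpa using h)
    have ih' := ih (fun d hd => h2 d (List.mem_of_mem_tail hd))
    simp only [qCF, cfValue] at p2 ⊢
    exact (hasValue_qInt a).add ((hasValue_q_zpow _).div
      ((hasValue_qIntInv b).add ((hasValue_q_zpow _).div ih' p1.ne')) p2.ne')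

theorem hasValue_qRat (x : ℚ) : HasValue (qRat x) x := by
  obtain ⟨-, h2, h3, -⟩ := evenCF_spec x
  have := hasValue_qCF (evenCF x) h2
  rwa [h3] at this

theorem qDelta_ne_zero (x : ℚ) : qDelta x ≠ 0 := by
  have h := (hasValue_qRat x).add (hasValue_neg_one.mul (hasValue_qRat (x - 1)))
  have e : qRat x + -1 * qRat (x - 1) = qDelta x := by rw [qDelta]; ring
  rw [e] at h
  exact h.ne_zero (by ring_nf; norm_num)

/-! ### Webs -/

/-- Objects: words in upward and downward arrows with positive labels. `gen j` is the upward and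
`cogen j` the downward arrow with label `j + 1`. -/
inductive Obj : Type
  | unit : Obj
  | tensor : Obj → Obj → Obj
  | gen : ℕ → Obj
  | cogen : ℕ → Obj

local infixr:70 " ⊗ₒ " => Obj.tensor

/-- The upward arrow with label `k`; an arrow with label `0` is erased. -/
def Obj.up : ℕ → Obj
  | 0 => .unit
  | j + 1 => .gen j

/-- Reversing all arrows and the order of the word. -/
def Obj.dual : Obj → Obj
  | .unit => .unit
  | .tensor X Y => Y.dual ⊗ₒ X.dual
  | .gen j => .cogen j
  | .cogen j => .gen j

open Obj (unit gen cogen up)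

/-- Formal `R`-linear combinations of webs drawn as vertical and horizontal compositions of
elementary pieces (read from bottom to top). -/
inductive PreHom (R : Type u) : Obj → Obj → Type u
  | id (X) : PreHom R X X
  | comp {X Y Z} (f : PreHom R X Y) (g : PreHom R Y Z) : PreHom R X Z
  | tens {X X' Y Y'} (f : PreHom R X X') (g : PreHom R Y Y') : PreHom R (X ⊗ₒ Y) (X' ⊗ₒ Y')
  | assoc (X Y Z) : PreHom R ((X ⊗ₒ Y) ⊗ₒ Z) (X ⊗ₒ (Y ⊗ₒ Z))
  | assocInv (X Y Z) : PreHom R (X ⊗ₒ (Y ⊗ₒ Z)) ((X ⊗ₒ Y) ⊗ₒ Z)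
  | lam (X) : PreHom R (unit ⊗ₒ X) X
  | lamInv (X) : PreHom R X (unit ⊗ₒ X)
  | rho (X) : PreHom R (X ⊗ₒ unit) X
  | rhoInv (X) : PreHom R X (X ⊗ₒ unit)
  | zero (X Y) : PreHom R X Y
  | add {X Y} (f g : PreHom R X Y) : PreHom R X Y
  | smul {X Y} (r : R) (f : PreHom R X Y) : PreHom R X Y
  /-- the trivalent vertex merging labels `i + 1` and `j + 1` -/
  | merge (i j m : ℕ) (h : (i + 1) + (j + 1) = m + 1) : PreHom R (gen i ⊗ₒ gen j) (gen m)
  /-- the trivalent vertex splitting into labels `i + 1` and `j + 1` -/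
  | split (i j m : ℕ) (h : (i + 1) + (j + 1) = m + 1) : PreHom R (gen m) (gen i ⊗ₒ gen j)
  /-- cup, oriented leftwards -/
  | cupUD (j : ℕ) : PreHom R unit (gen j ⊗ₒ cogen j)
  /-- cup, oriented rightwards -/
  | cupDU (j : ℕ) : PreHom R unit (cogen j ⊗ₒ gen j)
  /-- cap, oriented leftwards -/
  | capDU (j : ℕ) : PreHom R (cogen j ⊗ₒ gen j) unit
  /-- cap, oriented rightwards -/
  | capUD (j : ℕ) : PreHom R (gen j ⊗ₒ cogen j) unit

namespace PreHom

variable {R : Type u}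

local infixr:60 " ≫ₕ " => PreHom.comp
local infixr:70 " ⊗ₕ " => PreHom.tens

/-- The identity web between two names of the same label. -/
def relabel {k m : ℕ} (h : k = m) : PreHom R (up k) (up m) := h ▸ id (up k)

/-- Merging labels `k` and `l`; if one of them is `0` that edge is erased. -/
def mer : ∀ {k l m : ℕ}, k + l = m → PreHom R (up k ⊗ₒ up l) (up m)
  | 0, l, _, h => lam (up l) ≫ₕ relabel ((Nat.zero_add l).symm.trans h)
  | k + 1, 0, _, h => rho (up (k + 1)) ≫ₕ relabel h
  | k + 1, l + 1, m + 1, h => merge k l m h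

/-- Splitting into labels `k` and `l`; if one of them is `0` that edge is erased. -/
def spl : ∀ {k l m : ℕ}, k + l = m → PreHom R (up m) (up k ⊗ₒ up l)
  | 0, l, _, h => relabel (h.symm.trans (Nat.zero_add l)) ≫ₕ lamInv (up l)
  | k + 1, 0, _, h => relabel h.symm ≫ₕ rhoInv (up (k + 1))
  | k + 1, l + 1, m + 1, h => split k l m h

/-- The ladder with one rung labelled `b` from the left upright to the right one. -/
def rungR {k l k' l' : ℕ} (b : ℕ) (h : k' + b = k) (h' : b + l = l') :
    PreHom R (up k ⊗ₒ up l) (up k' ⊗ₒ up l') :=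
  (spl h ⊗ₕ id (up l)) ≫ₕ assoc _ _ _ ≫ₕ (id (up k') ⊗ₕ mer h')

/-- The ladder with one rung labelled `b` from the right upright to the left one. -/
def rungL {k l k' l' : ℕ} (b : ℕ) (h : k + b = k') (h' : b + l' = l) :
    PreHom R (up k ⊗ₒ up l) (up k' ⊗ₒ up l') :=
  (id (up k) ⊗ₕ spl h') ≫ₕ assocInv _ _ _ ≫ₕ (mer h ⊗ₕ id (up l'))

/-- A web on the first two of three strands. -/
def on12 {X Y X' Y' : Obj} (f : PreHom R (X ⊗ₒ Y) (X' ⊗ₒ Y')) (Z : Obj) :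
    PreHom R ((X ⊗ₒ Y) ⊗ₒ Z) ((X' ⊗ₒ Y') ⊗ₒ Z) :=
  f ⊗ₕ id Z

/-- A web on the last two of three strands. -/
def on23 (X : Obj) {Y Z Y' Z' : Obj} (f : PreHom R (Y ⊗ₒ Z) (Y' ⊗ₒ Z')) :
    PreHom R ((X ⊗ₒ Y) ⊗ₒ Z) ((X ⊗ₒ Y') ⊗ₒ Z') :=
  assoc _ _ _ ≫ₕ (id X ⊗ₕ f) ≫ₕ assocInv _ _ _

/-- Nested cups `unit → X ⊗ X*`. -/
def cupR : (X : Obj) → PreHom R unit (X ⊗ₒ X.dual)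
  | .unit => lamInv unit
  | .tensor X Y =>
      cupR X ≫ₕ (rhoInv X ⊗ₕ id X.dual) ≫ₕ ((id X ⊗ₕ cupR Y) ⊗ₕ id X.dual) ≫ₕ
        (assocInv X Y Y.dual ⊗ₕ id X.dual) ≫ₕ assoc (X ⊗ₒ Y) Y.dual X.dual
  | .gen j => cupUD j
  | .cogen j => cupDU j

/-- Nested cups `unit → X* ⊗ X`. -/
def cupL : (X : Obj) → PreHom R unit (X.dual ⊗ₒ X)
  | .unit => lamInv unit
  | .tensor X Y =>
      cupL Y ≫ₕ (rhoInv Y.dual ⊗ₕ id Y) ≫ₕ ((id Y.dual ⊗ₕ cupL X) ⊗ₕ id Y) ≫ₕ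
        (assocInv Y.dual X.dual X ⊗ₕ id Y) ≫ₕ assoc (Y.dual ⊗ₒ X.dual) X Y
  | .gen j => cupDU j
  | .cogen j => cupUD j

/-- Nested caps `X* ⊗ X → unit`. -/
def capL : (X : Obj) → PreHom R (X.dual ⊗ₒ X) unit
  | .unit => lam unit
  | .tensor X Y =>
      assocInv (Y.dual ⊗ₒ X.dual) X Y ≫ₕ (assoc Y.dual X.dual X ⊗ₕ id Y) ≫ₕ
        ((id Y.dual ⊗ₕ capL X) ⊗ₕ id Y) ≫ₕ (rho Y.dual ⊗ₕ id Y) ≫ₕ capL Y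
  | .gen j => capDU j
  | .cogen j => capUD j

/-- Nested caps `X ⊗ X* → unit`. -/
def capR : (X : Obj) → PreHom R (X ⊗ₒ X.dual) unit
  | .unit => lam unit
  | .tensor X Y =>
      assocInv (X ⊗ₒ Y) Y.dual X.dual ≫ₕ (assoc X Y Y.dual ⊗ₕ id X.dual) ≫ₕ
        ((id X ⊗ₕ capR Y) ⊗ₕ id X.dual) ≫ₕ (rho X ⊗ₕ id X.dual) ≫ₕ capR X
  | .gen j => capUD j
  | .cogen j => capDU j

/-- The web `f` rotated by a half turn counterclockwise. -/
def rotR {X Y : Obj} (f : PreHom R X Y) : PreHom R Y.dual X.dual :=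
  rhoInv Y.dual ≫ₕ (id Y.dual ⊗ₕ (cupR X ≫ₕ (f ⊗ₕ id X.dual))) ≫ₕ
    assocInv Y.dual Y X.dual ≫ₕ (capL Y ⊗ₕ id X.dual) ≫ₕ lam X.dual

/-- The web `f` rotated by a half turn clockwise. -/
def rotL {X Y : Obj} (f : PreHom R X Y) : PreHom R Y.dual X.dual :=
  lamInv Y.dual ≫ₕ ((cupL X ≫ₕ (id X.dual ⊗ₕ f)) ⊗ₕ id Y.dual) ≫ₕ
    assoc X.dual Y Y.dual ≫ₕ (id X.dual ⊗ₕ capR Y) ≫ₕ rho X.dual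

/-- Closing the rightmost strand of `f` around the right. -/
def traceR {A B : Obj} (X : Obj) (f : PreHom R (A ⊗ₒ X) (B ⊗ₒ X)) : PreHom R A B :=
  rhoInv A ≫ₕ (id A ⊗ₕ cupR X) ≫ₕ assocInv A X X.dual ≫ₕ (f ⊗ₕ id X.dual) ≫ₕ
    assoc B X X.dual ≫ₕ (id B ⊗ₕ capR X) ≫ₕ rho B

/-- Closing the leftmost strand of `f` around the left. -/
def traceL {A B : Obj} (X : Obj) (f : PreHom R (X ⊗ₒ A) (X ⊗ₒ B)) : PreHom R A B :=
  lamInv A ≫ₕ (cupL X ⊗ₕ id A) ≫ₕ assoc X.dual X A ≫ₕ (id X.dual ⊗ₕ f) ≫ₕ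
    assocInv X.dual X B ≫ₕ (capL X ⊗ₕ id B) ≫ₕ lam B

/-- Two strands labelled `1` merging into an edge labelled `2` and splitting again. -/
def dumbbell : PreHom R (up 1 ⊗ₒ up 1) (up 1 ⊗ₒ up 1) :=
  mer (m := 2) rfl ≫ₕ spl rfl

/-- The lower half of the mixed square: `dumbbell` rotated by a quarter turn clockwise. -/
def sideR : PreHom R (up 1 ⊗ₒ (up 1).dual) ((up 1).dual ⊗ₒ up 1) :=
  lamInv _ ≫ₕ (cupL (up 1) ⊗ₕ id _) ≫ₕ assoc _ _ _ ≫ₕ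
    (id _ ⊗ₕ (assocInv _ _ _ ≫ₕ (dumbbell ⊗ₕ id _) ≫ₕ assoc _ _ _ ≫ₕ
      (id _ ⊗ₕ capR (up 1)) ≫ₕ rho _))

/-- The upper half of the mixed square: `dumbbell` rotated by a quarter turn counterclockwise. -/
def sideL : PreHom R ((up 1).dual ⊗ₒ up 1) (up 1 ⊗ₒ (up 1).dual) :=
  rhoInv _ ≫ₕ (id _ ⊗ₕ cupR (up 1)) ≫ₕ assocInv _ _ _ ≫ₕ
    ((assoc _ _ _ ≫ₕ (id _ ⊗ₕ dumbbell) ≫ₕ assocInv _ _ _ ≫ₕ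
      (capL (up 1) ⊗ₕ id _) ≫ₕ lam _) ⊗ₕ id _)

/-! #### Relations -/

variable [CommRing R] [Algebra Kq R]

/-- The image in `R` of a rational fraction in `q`. -/
def sc (R : Type u) [CommRing R] [Algebra Kq R] (c : Kq) : R := algebraMap Kq R c

/-- `(a q^{-j} - a⁻¹ q^j) / (q - q⁻¹)`. -/
def aInt (a : Rˣ) (j : ℤ) : R :=
  ((a : R) * sc R (q ^ (-j)) - ((a⁻¹ : Rˣ) : R) * sc R (q ^ j)) * sc R (q - q⁻¹)⁻¹

/-- The relations on webs over a `ℚ(q)`-algebra `R` with a parameter `a ∈ Rˣ`: those of an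
`R`-linear monoidal category, planar isotopy, and the local web relations. -/
inductive Rel (a : Rˣ) : ∀ {X Y : Obj}, PreHom R X Y → PreHom R X Y → Prop
  -- congruence
  | refl {X Y} (f : PreHom R X Y) : Rel a f f
  | symm {X Y} {f g : PreHom R X Y} : Rel a f g → Rel a g f
  | trans {X Y} {f g h : PreHom R X Y} : Rel a f g → Rel a g h → Rel a f h
  | comp {X Y Z} {f f' : PreHom R X Y} {g g' : PreHom R Y Z} :
      Rel a f f' → Rel a g g' → Rel a (f ≫ₕ g) (f' ≫ₕ g')
  | tens {X X' Y Y'} {f f' : PreHom R X X'} {g g' : PreHom R Y Y'} :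
      Rel a f f' → Rel a g g' → Rel a (f ⊗ₕ g) (f' ⊗ₕ g')
  | add {X Y} {f f' g g' : PreHom R X Y} :
      Rel a f f' → Rel a g g' → Rel a (add f g) (add f' g')
  | smul {X Y} (r : R) {f f' : PreHom R X Y} : Rel a f f' → Rel a (smul r f) (smul r f')
  -- linear structure
  | add_assoc {X Y} (f g h : PreHom R X Y) : Rel a (add (add f g) h) (add f (add g h))
  | add_comm {X Y} (f g : PreHom R X Y) : Rel a (add f g) (add g f)
  | zero_add {X Y} (f : PreHom R X Y) : Rel a (add (zero X Y) f) f
  | one_smul {X Y} (f : PreHom R X Y) : Rel a (smul 1 f) f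
  | mul_smul {X Y} (r s : R) (f : PreHom R X Y) : Rel a (smul (r * s) f) (smul r (smul s f))
  | smul_add {X Y} (r : R) (f g : PreHom R X Y) :
      Rel a (smul r (add f g)) (add (smul r f) (smul r g))
  | add_smul {X Y} (r s : R) (f : PreHom R X Y) :
      Rel a (smul (r + s) f) (add (smul r f) (smul s f))
  | zero_smul {X Y} (f : PreHom R X Y) : Rel a (smul 0 f) (zero X Y)
  -- category, with bilinear composition
  | id_comp {X Y} (f : PreHom R X Y) : Rel a (id X ≫ₕ f) f
  | comp_id {X Y} (f : PreHom R X Y) : Rel a (f ≫ₕ id Y) f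
  | comp_assoc {W X Y Z} (f : PreHom R W X) (g : PreHom R X Y) (h : PreHom R Y Z) :
      Rel a ((f ≫ₕ g) ≫ₕ h) (f ≫ₕ (g ≫ₕ h))
  | add_comp {X Y Z} (f f' : PreHom R X Y) (g : PreHom R Y Z) :
      Rel a (add f f' ≫ₕ g) (add (f ≫ₕ g) (f' ≫ₕ g))
  | comp_add {X Y Z} (f : PreHom R X Y) (g g' : PreHom R Y Z) :
      Rel a (f ≫ₕ add g g') (add (f ≫ₕ g) (f ≫ₕ g'))
  | smul_comp {X Y Z} (r : R) (f : PreHom R X Y) (g : PreHom R Y Z) :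
      Rel a (smul r f ≫ₕ g) (smul r (f ≫ₕ g))
  | comp_smul {X Y Z} (f : PreHom R X Y) (r : R) (g : PreHom R Y Z) :
      Rel a (f ≫ₕ smul r g) (smul r (f ≫ₕ g))
  -- monoidal category, with bilinear tensor product
  | id_tens (X Y) : Rel a (id X ⊗ₕ id Y) (id (X ⊗ₒ Y))
  | tens_comp {X₁ Y₁ Z₁ X₂ Y₂ Z₂} (f₁ : PreHom R X₁ Y₁) (f₂ : PreHom R X₂ Y₂)
      (g₁ : PreHom R Y₁ Z₁) (g₂ : PreHom R Y₂ Z₂) :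
      Rel a ((f₁ ⊗ₕ f₂) ≫ₕ (g₁ ⊗ₕ g₂)) ((f₁ ≫ₕ g₁) ⊗ₕ (f₂ ≫ₕ g₂))
  | add_tens {X X' Y Y'} (f f' : PreHom R X X') (g : PreHom R Y Y') :
      Rel a (add f f' ⊗ₕ g) (add (f ⊗ₕ g) (f' ⊗ₕ g))
  | tens_add {X X' Y Y'} (f : PreHom R X X') (g g' : PreHom R Y Y') :
      Rel a (f ⊗ₕ add g g') (add (f ⊗ₕ g) (f ⊗ₕ g'))
  | smul_tens {X X' Y Y'} (r : R) (f : PreHom R X X') (g : PreHom R Y Y') :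
      Rel a (smul r f ⊗ₕ g) (smul r (f ⊗ₕ g))
  | tens_smul {X X' Y Y'} (f : PreHom R X X') (r : R) (g : PreHom R Y Y') :
      Rel a (f ⊗ₕ smul r g) (smul r (f ⊗ₕ g))
  | assoc_hom_inv (X Y Z) : Rel a (assoc X Y Z ≫ₕ assocInv X Y Z) (id _)
  | assoc_inv_hom (X Y Z) : Rel a (assocInv X Y Z ≫ₕ assoc X Y Z) (id _)
  | lam_hom_inv (X) : Rel a (lam X ≫ₕ lamInv X) (id _)
  | lam_inv_hom (X) : Rel a (lamInv X ≫ₕ lam X) (id _)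
  | rho_hom_inv (X) : Rel a (rho X ≫ₕ rhoInv X) (id _)
  | rho_inv_hom (X) : Rel a (rhoInv X ≫ₕ rho X) (id _)
  | assoc_nat {X X' Y Y' Z Z'} (f : PreHom R X X') (g : PreHom R Y Y') (h : PreHom R Z Z') :
      Rel a (((f ⊗ₕ g) ⊗ₕ h) ≫ₕ assoc X' Y' Z') (assoc X Y Z ≫ₕ (f ⊗ₕ (g ⊗ₕ h)))
  | lam_nat {X Y} (f : PreHom R X Y) : Rel a ((id unit ⊗ₕ f) ≫ₕ lam Y) (lam X ≫ₕ f)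
  | rho_nat {X Y} (f : PreHom R X Y) : Rel a ((f ⊗ₕ id unit) ≫ₕ rho Y) (rho X ≫ₕ f)
  | pentagon (W X Y Z) :
      Rel a ((assoc W X Y ⊗ₕ id Z) ≫ₕ assoc W (X ⊗ₒ Y) Z ≫ₕ (id W ⊗ₕ assoc X Y Z))
        (assoc (W ⊗ₒ X) Y Z ≫ₕ assoc W X (Y ⊗ₒ Z))
  | triangle (X Y) : Rel a (assoc X unit Y ≫ₕ (id X ⊗ₕ lam Y)) (rho X ⊗ₕ id Y)
  -- planar isotopy: straightening of strands, and full turns of trivalent vertices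
  | zigzag₁ (j : ℕ) :
      Rel a ((cupUD j ⊗ₕ id (gen j)) ≫ₕ assoc _ _ _ ≫ₕ (id (gen j) ⊗ₕ capDU j))
        (lam _ ≫ₕ rhoInv _)
  | zigzag₂ (j : ℕ) :
      Rel a ((id (cogen j) ⊗ₕ cupUD j) ≫ₕ assocInv _ _ _ ≫ₕ (capDU j ⊗ₕ id (cogen j)))
        (rho _ ≫ₕ lamInv _)
  | zigzag₃ (j : ℕ) :
      Rel a ((cupDU j ⊗ₕ id (cogen j)) ≫ₕ assoc _ _ _ ≫ₕ (id (cogen j) ⊗ₕ capUD j))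
        (lam _ ≫ₕ rhoInv _)
  | zigzag₄ (j : ℕ) :
      Rel a ((id (gen j) ⊗ₕ cupDU j) ≫ₕ assocInv _ _ _ ≫ₕ (capUD j ⊗ₕ id (gen j)))
        (rho _ ≫ₕ lamInv _)
  | rot_merge (i j m : ℕ) (h : (i + 1) + (j + 1) = m + 1) :
      Rel a (rotR (merge i j m h)) (rotL (merge i j m h))
  | rot_split (i j m : ℕ) (h : (i + 1) + (j + 1) = m + 1) :
      Rel a (rotR (split i j m h)) (rotL (split i j m h))
  -- associativity and coassociativity of the vertices
  | mer_assoc {k l r s t m : ℕ} (h₁ : k + l = s) (h₂ : s + r = m) (h₃ : l + r = t)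
      (h₄ : k + t = m) :
      Rel a ((mer h₁ ⊗ₕ id (up r)) ≫ₕ mer h₂) (assoc _ _ _ ≫ₕ (id (up k) ⊗ₕ mer h₃) ≫ₕ mer h₄)
  | spl_assoc {k l r s t m : ℕ} (h₁ : k + l = s) (h₂ : s + r = m) (h₃ : l + r = t)
      (h₄ : k + t = m) :
      Rel a (spl h₂ ≫ₕ (spl h₁ ⊗ₕ id (up r))) (spl h₄ ≫ₕ (id (up k) ⊗ₕ spl h₃) ≫ₕ assocInv _ _ _)
  -- digon removal
  | digon {k l m : ℕ} (h : k + l = m) :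
      Rel a (spl h ≫ₕ mer h)
        (smul (sc R (q ^ (-(k * l : ℤ)) * qIntBinom (k + l) k)) (id (up m)))
  -- square switch, for uprights labelled `k = k' + 1` and `l = l' + 1`
  | square (k' l' : ℕ) :
      Rel a (rungR (k := k' + 1) (l := l' + 1) (k' := k') (l' := l' + 2) 1 (by omega) (by omega) ≫ₕ
          rungL (k' := k' + 1) (l' := l' + 1) 1 (by omega) (by omega))
        (add (rungL (k := k' + 1) (l := l' + 1) (k' := k' + 2) (l' := l') 1
              (by omega) (by omega) ≫ₕ
            rungR (k' := k' + 1) (l' := l' + 1) 1 (by omega) (by omega))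
          (smul (sc R (q ^ (1 - (k' + 1) + (l' + 1) : ℤ) * qInt ((k' + 1) - (l' + 1))))
            (id (up (k' + 1) ⊗ₒ up (l' + 1)))))
  -- cubic (Serre) relations, the third term being zero if an edge has a negative label
  | serre₁ (k l r : ℕ) :
      Rel a
        (add
          (on23 (up k) (rungL (k := l + 2) (l := r + 1) (k' := l + 3) (l' := r) 1
              (by omega) (by omega)) ≫ₕ
            on12 (rungL (k' := k + 2) (l' := l + 1) 2 (by omega) (by omega)) (up r))
          (on12 (rungL (k := k) (l := l + 2) (k' := k + 2) (l' := l) 2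
              (by omega) (by omega)) (up (r + 1)) ≫ₕ
            on23 (up (k + 2)) (rungL (k' := l + 1) (l' := r) 1 (by omega) (by omega))))
        (on12 (rungL (k := k) (l := l + 2) (k' := k + 1) (l' := l + 1) 1
            (by omega) (by omega)) (up (r + 1)) ≫ₕ
          on23 (up (k + 1)) (rungL (k' := l + 2) (l' := r) 1 (by omega) (by omega)) ≫ₕ
          on12 (rungL (k' := k + 2) (l' := l + 1) 1 (by omega) (by omega)) (up r))
  | serre₁' (k r : ℕ) :
      Rel a
        (on23 (up k) (rungL (k := 1) (l := r + 1) (k' := 2) (l' := r) 1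
            (by omega) (by omega)) ≫ₕ
          on12 (rungL (k' := k + 2) (l' := 0) 2 (by omega) (by omega)) (up r))
        (on12 (rungL (k := k) (l := 1) (k' := k + 1) (l' := 0) 1
            (by omega) (by omega)) (up (r + 1)) ≫ₕ
          on23 (up (k + 1)) (rungL (k' := 1) (l' := r) 1 (by omega) (by omega)) ≫ₕ
          on12 (rungL (k' := k + 2) (l' := 0) 1 (by omega) (by omega)) (up r))
  | serre₂ (k l r : ℕ) :
      Rel a
        (add
          (on12 (rungL (k := k) (l := l + 1) (k' := k + 1) (l' := l) 1
              (by omega) (by omega)) (up (r + 2)) ≫ₕ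
            on23 (up (k + 1)) (rungL (k' := l + 2) (l' := r) 2 (by omega) (by omega)))
          (on23 (up k) (rungL (k := l + 1) (l := r + 2) (k' := l + 3) (l' := r) 2
              (by omega) (by omega)) ≫ₕ
            on12 (rungL (k' := k + 1) (l' := l + 2) 1 (by omega) (by omega)) (up r)))
        (on23 (up k) (rungL (k := l + 1) (l := r + 2) (k' := l + 2) (l' := r + 1) 1
            (by omega) (by omega)) ≫ₕ
          on12 (rungL (k' := k + 1) (l' := l + 1) 1 (by omega) (by omega)) (up (r + 1)) ≫ₕ
          on23 (up (k + 1)) (rungL (k' := l + 2) (l' := r) 1 (by omega) (by omega)))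
  | serre₃ (k l r : ℕ) :
      Rel a
        (add
          (on23 (up (k + 2)) (rungR (k := l + 1) (l := r) (k' := l) (l' := r + 1) 1
              (by omega) (by omega)) ≫ₕ
            on12 (rungR (k' := k) (l' := l + 2) 2 (by omega) (by omega)) (up (r + 1)))
          (on12 (rungR (k := k + 2) (l := l + 1) (k' := k) (l' := l + 3) 2
              (by omega) (by omega)) (up r) ≫ₕ
            on23 (up k) (rungR (k' := l + 2) (l' := r + 1) 1 (by omega) (by omega))))
        (on12 (rungR (k := k + 2) (l := l + 1) (k' := k + 1) (l' := l + 2) 1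
            (by omega) (by omega)) (up r) ≫ₕ
          on23 (up (k + 1)) (rungR (k' := l + 1) (l' := r + 1) 1 (by omega) (by omega)) ≫ₕ
          on12 (rungR (k' := k) (l' := l + 2) 1 (by omega) (by omega)) (up (r + 1)))
  | serre₄ (k l r : ℕ) :
      Rel a
        (add
          (on12 (rungR (k := k + 1) (l := l + 2) (k' := k) (l' := l + 3) 1
              (by omega) (by omega)) (up r) ≫ₕ
            on23 (up k) (rungR (k' := l + 1) (l' := r + 2) 2 (by omega) (by omega)))
          (on23 (up (k + 1)) (rungR (k := l + 2) (l := r) (k' := l) (l' := r + 2) 2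
              (by omega) (by omega)) ≫ₕ
            on12 (rungR (k' := k) (l' := l + 1) 1 (by omega) (by omega)) (up (r + 2))))
        (on23 (up (k + 1)) (rungR (k := l + 2) (l := r) (k' := l + 1) (l' := r + 1) 1
            (by omega) (by omega)) ≫ₕ
          on12 (rungR (k' := k) (l' := l + 2) 1 (by omega) (by omega)) (up (r + 1)) ≫ₕ
          on23 (up k) (rungR (k' := l + 1) (l' := r + 2) 1 (by omega) (by omega)))
  | serre₄' (k r : ℕ) :
      Rel a
        (on12 (rungR (k := k + 1) (l := 1) (k' := k) (l' := 2) 1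
            (by omega) (by omega)) (up r) ≫ₕ
          on23 (up k) (rungR (k' := 0) (l' := r + 2) 2 (by omega) (by omega)))
        (on23 (up (k + 1)) (rungR (k := 1) (l := r) (k' := 0) (l' := r + 1) 1
            (by omega) (by omega)) ≫ₕ
          on12 (rungR (k' := k) (l' := 1) 1 (by omega) (by omega)) (up (r + 1)) ≫ₕ
          on23 (up k) (rungR (k' := 0) (l' := r + 2) 1 (by omega) (by omega)))
  -- evaluation of circles labelled `1`
  | circleR : Rel a (cupR (up 1) ≫ₕ capR (up 1)) (smul (aInt a 0) (id unit))
  | circleL : Rel a (cupL (up 1) ≫ₕ capL (up 1)) (smul (aInt a 0) (id unit))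
  -- sideways digons
  | sideDigonR : Rel a (traceR (up 1) dumbbell) (smul (aInt a 1) (id (up 1)))
  | sideDigonL : Rel a (traceL (up 1) dumbbell) (smul (aInt a 1) (id (up 1)))
  -- mixed squares
  | mixedR : Rel a (sideR ≫ₕ sideL)
      (add (id _) (smul (aInt a 2) (capR (up 1) ≫ₕ cupR (up 1))))
  | mixedL : Rel a (sideL ≫ₕ sideR)
      (add (id _) (smul (aInt a 2) (capL (up 1) ≫ₕ cupL (up 1))))

end PreHom

/-- The web category over the `ℚ(q)`-algebra `R` with parameter `a`. -/
def Web (R : Type u) [CommRing R] [Algebra Kq R] (_a : Rˣ) : Type := Obj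

section Category

variable {R : Type u} [CommRing R] [Algebra Kq R] {a : Rˣ}

open PreHom

/-- Equality of webs modulo the relations. -/
def homSetoid (a : Rˣ) (X Y : Obj) : Setoid (PreHom R X Y) :=
  ⟨Rel a, Rel.refl, Rel.symm, Rel.trans⟩

instance : Category.{u} (Web R a) where
  Hom X Y := Quotient (homSetoid a X Y)
  id X := Quotient.mk _ (PreHom.id X)
  comp := Quotient.map₂ PreHom.comp (fun _ _ hf _ _ hg => Rel.comp hf hg)
  id_comp := by rintro X Y ⟨f⟩; exact Quotient.sound (Rel.id_comp f)
  comp_id := by rintro X Y ⟨f⟩; exact Quotient.sound (Rel.comp_id f)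
  assoc := by rintro W X Y Z ⟨f⟩ ⟨g⟩ ⟨h⟩; exact Quotient.sound (Rel.comp_assoc f g h)

/-- A word in arrows as an object of `Web R a`. -/
def of (a : Rˣ) (X : Obj) : Web R a := X

/-- The morphism of `Web R a` represented by a formal combination of webs. -/
def mk (a : Rˣ) {X Y : Obj} (f : PreHom R X Y) : of a X ⟶ of a Y :=
  Quotient.mk (homSetoid a X Y) f

theorem mk_eq {X Y : Obj} {f g : PreHom R X Y} (h : Rel a f g) : mk a f = mk a g :=
  Quotient.sound h

instance : MonoidalCategoryStruct (Web R a) where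
  tensorObj X Y := Obj.tensor X Y
  tensorUnit := Obj.unit
  tensorHom := Quotient.map₂ PreHom.tens (fun _ _ hf _ _ hg => Rel.tens hf hg)
  whiskerLeft X _ _ f := Quotient.map (fun f => PreHom.tens (PreHom.id X) f)
    (fun _ _ hf => Rel.tens (Rel.refl _) hf) f
  whiskerRight f Y := Quotient.map (fun f => PreHom.tens f (PreHom.id Y))
    (fun _ _ hf => Rel.tens hf (Rel.refl _)) f
  associator X Y Z := ⟨mk a (assoc X Y Z), mk a (assocInv X Y Z),
    mk_eq (Rel.assoc_hom_inv X Y Z), mk_eq (Rel.assoc_inv_hom X Y Z)⟩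
  leftUnitor X := ⟨mk a (lam X), mk a (lamInv X), mk_eq (Rel.lam_hom_inv X),
    mk_eq (Rel.lam_inv_hom X)⟩
  rightUnitor X := ⟨mk a (rho X), mk a (rhoInv X), mk_eq (Rel.rho_hom_inv X),
    mk_eq (Rel.rho_inv_hom X)⟩

instance : MonoidalCategory (Web R a) := MonoidalCategory.ofTensorHom
  (id_tensorHom_id := fun X Y => mk_eq (Rel.id_tens X Y))
  (id_tensorHom := by rintro X Y Z ⟨f⟩; rfl)
  (tensorHom_id := by rintro X Y ⟨f⟩ Z; rfl)
  (tensorHom_comp_tensorHom := by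
    rintro _ _ _ _ _ _ ⟨f₁⟩ ⟨f₂⟩ ⟨g₁⟩ ⟨g₂⟩; exact mk_eq (Rel.tens_comp f₁ f₂ g₁ g₂))
  (associator_naturality := by
    rintro _ _ _ _ _ _ ⟨f⟩ ⟨g⟩ ⟨h⟩; exact mk_eq (Rel.assoc_nat f g h))
  (leftUnitor_naturality := by rintro _ _ ⟨f⟩; exact mk_eq (Rel.lam_nat f))
  (rightUnitor_naturality := by rintro _ _ ⟨f⟩; exact mk_eq (Rel.rho_nat f))
  (pentagon := fun W X Y Z => mk_eq (Rel.pentagon W X Y Z))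
  (triangle := fun X Y => mk_eq (Rel.triangle X Y))

instance (X Y : Web R a) : Add (X ⟶ Y) :=
  ⟨Quotient.map₂ PreHom.add (fun _ _ hf _ _ hg => Rel.add hf hg)⟩

instance (X Y : Web R a) : Zero (X ⟶ Y) := ⟨mk a (PreHom.zero X Y)⟩

instance (X Y : Web R a) : Neg (X ⟶ Y) :=
  ⟨Quotient.map (PreHom.smul (-1)) (fun _ _ hf => Rel.smul _ hf)⟩

instance (X Y : Web R a) : AddCommGroup (X ⟶ Y) where
  add_assoc := by rintro ⟨f⟩ ⟨g⟩ ⟨h⟩; exact mk_eq (Rel.add_assoc f g h)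
  add_comm := by rintro ⟨f⟩ ⟨g⟩; exact mk_eq (Rel.add_comm f g)
  zero_add := by rintro ⟨f⟩; exact mk_eq (Rel.zero_add f)
  add_zero := by
    rintro ⟨f⟩; exact mk_eq (Rel.trans (Rel.add_comm f _) (Rel.zero_add f))
  neg_add_cancel := by
    rintro ⟨f⟩
    refine mk_eq (Rel.trans (Rel.add (Rel.refl _) (Rel.symm (Rel.one_smul f))) ?_)
    refine Rel.trans (Rel.symm (Rel.add_smul _ _ f)) ?_
    rw [neg_add_cancel]
    exact Rel.zero_smul f
  nsmul := nsmulRec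
  zsmul := zsmulRec

instance (X Y : Web R a) : Module R (X ⟶ Y) where
  smul r := Quotient.map (PreHom.smul r) (fun _ _ hf => Rel.smul _ hf)
  one_smul := by rintro ⟨f⟩; exact mk_eq (Rel.one_smul f)
  mul_smul := by rintro r s ⟨f⟩; exact mk_eq (Rel.mul_smul r s f)
  smul_add := by rintro r ⟨f⟩ ⟨g⟩; exact mk_eq (Rel.smul_add r f g)
  add_smul := by rintro r s ⟨f⟩; exact mk_eq (Rel.add_smul r s f)
  zero_smul := by rintro ⟨f⟩; exact mk_eq (Rel.zero_smul f)
  smul_zero := by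
    intro r
    refine mk_eq (Rel.trans (Rel.smul r (Rel.symm (Rel.zero_smul (PreHom.zero X Y)))) ?_)
    refine Rel.trans (Rel.symm (Rel.mul_smul r 0 _)) ?_
    rw [mul_zero]
    exact Rel.zero_smul _

instance : Preadditive (Web R a) where
  add_comp := by rintro _ _ _ ⟨f⟩ ⟨f'⟩ ⟨g⟩; exact mk_eq (Rel.add_comp f f' g)
  comp_add := by rintro _ _ _ ⟨f⟩ ⟨g⟩ ⟨g'⟩; exact mk_eq (Rel.comp_add f g g')

instance : Linear R (Web R a) where
  smul_comp := by rintro _ _ _ r ⟨f⟩ ⟨g⟩; exact mk_eq (Rel.smul_comp r f g)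
  comp_smul := by rintro _ _ _ ⟨f⟩ r ⟨g⟩; exact mk_eq (Rel.comp_smul f r g)

theorem whiskerLeft_smul (X : Web R a) {Y Z : Web R a} (r : R) (f : Y ⟶ Z) :
    X ◁ (r • f) = r • (X ◁ f) := by
  obtain ⟨f⟩ := f; exact mk_eq (Rel.tens_smul _ r f)

theorem smul_whiskerRight (r : R) {Y Z : Web R a} (f : Y ⟶ Z) (X : Web R a) :
    (r • f) ▷ X = r • (f ▷ X) := by
  obtain ⟨f⟩ := f; exact mk_eq (Rel.smul_tens r f _)

instance : MonoidalPreadditive (Web R a) where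
  whiskerLeft_zero {X Y Z} := by
    rw [← zero_smul R (0 : Y ⟶ Z), whiskerLeft_smul, zero_smul]
  zero_whiskerRight {X Y Z} := by
    rw [← zero_smul R (0 : Y ⟶ Z), smul_whiskerRight, zero_smul]
  whiskerLeft_add := by rintro X _ _ ⟨f⟩ ⟨g⟩; exact mk_eq (Rel.tens_add _ f g)
  add_whiskerRight := by rintro X _ _ ⟨f⟩ ⟨g⟩; exact mk_eq (Rel.add_tens f g _)

instance : MonoidalLinear R (Web R a) where
  whiskerLeft_smul := whiskerLeft_smul
  smul_whiskerRight := smul_whiskerRight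

end Category

/-! ### Coloured tangle diagrams and their values -/

/-- Oriented coloured tangle diagrams, drawn as compositions of cups, caps and crossings of two
upward strands (read from bottom to top). -/
inductive Diagram : Obj → Obj → Type
  | id (X) : Diagram X X
  | comp {X Y Z} (D : Diagram X Y) (E : Diagram Y Z) : Diagram X Z
  | tens {X X' Y Y'} (D : Diagram X X') (E : Diagram Y Y') : Diagram (X ⊗ₒ Y) (X' ⊗ₒ Y')
  | assoc (X Y Z) : Diagram ((X ⊗ₒ Y) ⊗ₒ Z) (X ⊗ₒ (Y ⊗ₒ Z))
  | assocInv (X Y Z) : Diagram (X ⊗ₒ (Y ⊗ₒ Z)) ((X ⊗ₒ Y) ⊗ₒ Z)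
  | lam (X) : Diagram (unit ⊗ₒ X) X
  | lamInv (X) : Diagram X (unit ⊗ₒ X)
  | rho (X) : Diagram (X ⊗ₒ unit) X
  | rhoInv (X) : Diagram X (X ⊗ₒ unit)
  /-- cup, oriented leftwards -/
  | cupUD (k : ℕ) : Diagram unit (up k ⊗ₒ (up k).dual)
  /-- cup, oriented rightwards -/
  | cupDU (k : ℕ) : Diagram unit ((up k).dual ⊗ₒ up k)
  /-- cap, oriented leftwards -/
  | capDU (k : ℕ) : Diagram ((up k).dual ⊗ₒ up k) unit
  /-- cap, oriented rightwards -/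
  | capUD (k : ℕ) : Diagram (up k ⊗ₒ (up k).dual) unit
  /-- the crossing whose strand from bottom left to top right is over -/
  | over (k l : ℕ) : Diagram (up k ⊗ₒ up l) (up l ⊗ₒ up k)
  /-- the crossing whose strand from bottom right to top left is over -/
  | under (k l : ℕ) : Diagram (up k ⊗ₒ up l) (up l ⊗ₒ up k)

/-- A link diagram is a diagram without end points. -/
abbrev LinkDiagram : Type := Diagram unit unit

section Value

variable {R : Type u} [CommRing R] [Algebra Kq R] (a : Rˣ)

/-- The ladder in the braiding formula for `over`, with lower rung `k - j` to the right and upper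
rung `l - j` to the left. -/
def overTerm (k l : ℕ) (j : Fin (min k l + 1)) : PreHom R (up k ⊗ₒ up l) (up l ⊗ₒ up k) :=
  (PreHom.rungR (k' := j) (l' := k + l - j) (k - j) (by omega) (by omega)).comp
    (PreHom.rungL (l - j) (by omega) (by omega))

/-- The ladder in the braiding formula for `under`, with lower rung `l - j` to the left and upper
rung `k - j` to the right. -/
def underTerm (k l : ℕ) (j : Fin (min k l + 1)) : PreHom R (up k ⊗ₒ up l) (up l ⊗ₒ up k) :=
  (PreHom.rungL (k' := k + l - j) (l' := j) (l - j) (by omega) (by omega)).comp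
    (PreHom.rungR (k - j) (by omega) (by omega))

/-- `(-q)^{kl} ∑ (-q)^{b-k}` (ladder with lower rung `b` and upper rung `c`), the sum being over
`b, c ≥ 0` with `b - c = k - l`; it is indexed by `j = k - b = l - c`. -/
def braiding (k l : ℕ) : of a (up k ⊗ₒ up l) ⟶ of a (up l ⊗ₒ up k) :=
  PreHom.sc R ((-q) ^ (k * l)) •
    ∑ j : Fin (min k l + 1), PreHom.sc R ((-q) ^ (-(j : ℤ))) • mk a (overTerm k l j)

/-- `(-q)^{-kl} ∑ (-q)^{l-b}` (ladder with lower rung `b` and upper rung `c`), the sum being over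
`b, c ≥ 0` with `b - c = l - k`; it is indexed by `j = l - b = k - c`. -/
def braidingInv (k l : ℕ) : of a (up k ⊗ₒ up l) ⟶ of a (up l ⊗ₒ up k) :=
  PreHom.sc R ((-q) ^ (-(k * l : ℤ))) •
    ∑ j : Fin (min k l + 1), PreHom.sc R ((-q) ^ (j : ℕ)) • mk a (underTerm k l j)

/-- The morphism of `Web R a` given by a tangle diagram. -/
def value : ∀ {X Y : Obj}, Diagram X Y → (of a X ⟶ of a Y)
  | _, _, .id X => mk a (.id X)
  | _, _, .comp D E => value D ≫ value E
  | _, _, .tens D E => value D ⊗ₘ value E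
  | _, _, .assoc X Y Z => mk a (.assoc X Y Z)
  | _, _, .assocInv X Y Z => mk a (.assocInv X Y Z)
  | _, _, .lam X => mk a (.lam X)
  | _, _, .lamInv X => mk a (.lamInv X)
  | _, _, .rho X => mk a (.rho X)
  | _, _, .rhoInv X => mk a (.rhoInv X)
  | _, _, .cupUD k => mk a (PreHom.cupR (up k))
  | _, _, .cupDU k => mk a (PreHom.cupL (up k))
  | _, _, .capDU k => mk a (PreHom.capL (up k))
  | _, _, .capUD k => mk a (PreHom.capR (up k))
  | _, _, .over k l => braiding a k l
  | _, _, .under k l => braidingInv a k l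

/-- The value of a link diagram in `End(∅)`. -/
def linkValue (D : LinkDiagram) : 𝟙_ (Web R a) ⟶ 𝟙_ (Web R a) := value a D

/-- The value of the link diagram `D` in `End(∅)` is the scalar `r`. -/
def HasLinkValue (D : LinkDiagram) (r : R) : Prop :=
  linkValue a D = r • 𝟙 (𝟙_ (Web R a))

end Value

/-- The ring `ℚ(q)[a, a⁻¹]`. -/
abbrev Ka : Type := Kq[T;T⁻¹]

/-- The variable `a` of `ℚ(q)[a, a⁻¹]`. -/
def aVar : Kaˣ :=
  ⟨LaurentPolynomial.T 1, LaurentPolynomial.T (-1),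
    by rw [← LaurentPolynomial.T_add]; simp, by rw [← LaurentPolynomial.T_add]; simp⟩

/-- The HOMFLY-PT polynomial of the diagram `D` is `P`. -/
def IsHomflyPT (D : LinkDiagram) (P : Ka) : Prop := HasLinkValue aVar D P

section XInvariant

variable {R : Type u} [CommRing R] [Algebra Kq R]

theorem sq_mul_qDelta {x : ℚ} {ν : R} (hν : ν ^ 2 = algebraMap Kq R (qDelta x)⁻¹) :
    ν * ν * algebraMap Kq R (qDelta x) = 1 := by
  rw [← pow_two, hν, ← map_mul, inv_mul_cancel₀ (qDelta_ne_zero x), map_one]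

/-- `a_x = q ν_x δ_x`, with inverse `q⁻¹ ν_x`. -/
def aSpec (x : ℚ) (ν : R) (hν : ν ^ 2 = algebraMap Kq R (qDelta x)⁻¹) : Rˣ where
  val := algebraMap Kq R q * ν * algebraMap Kq R (qDelta x)
  inv := algebraMap Kq R q⁻¹ * ν
  val_inv := by
    have h := sq_mul_qDelta hν
    have hq : algebraMap Kq R q * algebraMap Kq R q⁻¹ = 1 := by
      rw [← map_mul, mul_inv_cancel₀ q_ne_zero, map_one]
    linear_combination (algebraMap Kq R q * algebraMap Kq R q⁻¹) * h + hq
  inv_val := by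
    have h := sq_mul_qDelta hν
    have hq : algebraMap Kq R q * algebraMap Kq R q⁻¹ = 1 := by
      rw [← map_mul, mul_inv_cancel₀ q_ne_zero, map_one]
    linear_combination (algebraMap Kq R q * algebraMap Kq R q⁻¹) * h + hq

/-- The `x`-invariant of the link diagram `D` is `r`: this is the value at `a = q ν_x δ_x` of the
HOMFLY-PT polynomial of `D`, and the scalar by which `D` acts in the category `xWeb`, that is the
web category with parameter `a = q ν_x δ_x`. -/
def IsXInvariant (x : ℚ) (ν : R) (hν : ν ^ 2 = algebraMap Kq R (qDelta x)⁻¹)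
    (D : LinkDiagram) (r : R) : Prop :=
  (∃ P : Ka, IsHomflyPT D P ∧
    LaurentPolynomial.eval₂ (algebraMap Kq R) (aSpec x ν hν) P = r) ∧
  HasLinkValue (aSpec x ν hν) D r

end XInvariant

/-- The extension `ℚ(q)[ν_x]`, with `ν_x ^ 2 = δ_x⁻¹`. -/
abbrev NuExt (x : ℚ) : Type := AdjoinRoot (Polynomial.X ^ 2 - Polynomial.C (qDelta x)⁻¹)

/-- The element `ν_x` of `ℚ(q)[ν_x]`. -/
def nu (x : ℚ) : NuExt x := AdjoinRoot.root _

theorem nu_sq (x : ℚ) : nu x ^ 2 = algebraMap Kq (NuExt x) (qDelta x)⁻¹ := by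
  have h := AdjoinRoot.eval₂_root (Polynomial.X ^ 2 - Polynomial.C (qDelta x)⁻¹)
  simp only [Polynomial.eval₂_sub, Polynomial.eval₂_pow, Polynomial.eval₂_X,
    Polynomial.eval₂_C] at h
  exact sub_eq_zero.mp h

/-- The once stabilized unknot coloured by `k`: a figure eight whose two strands at the crossing
both point upwards, the strand from bottom right to top left being over; the two left end points
of the crossing are joined around the left, the two right end points around the right. -/
def stabilizedUnknot (k : ℕ) : LinkDiagram :=
  .comp (.lamInv _) <| .comp (.tens (.cupDU k) (.cupUD k)) <|
  .comp (.assoc _ _ _) <| .comp (.tens (.id _) (.assocInv _ _ _)) <|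
  .comp (.tens (.id _) (.tens (.under k k) (.id _))) <|
  .comp (.tens (.id _) (.assoc _ _ _)) <| .comp (.assocInv _ _ _) <|
  .comp (.tens (.capDU k) (.capUD k)) (.lam _)

end

end QWeb

/-! Write `[n]` for the symmetric quantum integer `qSym n` and `[a; j]` for `aInt a j`. The figure
eight is the crossing closed on the right and then on the left (`figureEight`). If the right closure
of the crossing is a scalar times the identity strand, the value of the link is that scalar times a
circle labelled `k`.

The closures are computed by sliding a merge vertex around the closing arc (`ptr_mrg_cyclic`,
`closure_mrg_cyclic`). This is legitimate because the clockwise and counterclockwise half turns of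
the vertex agree. Closing an edge labelled `1` of a dumbbell follows from the square switch
(`ptr_dumbbell_one`). Inserting a digon on an edge labelled `l + 1` and sliding its merge vertex
reduces general labels to this case, so `ptr_dumbbell` gives the quantum binomial `[a; k] ⋯ [a; k +
l - 1] / [l]!`. The same method on the left evaluates circles (`circleL`). Each ladder in the
crossing then closes to a product of two such binomials (`ptr_ladder`), whose numerators join to a
run of `k` consecutive brackets `[a; c] ⋯ [a; c + k - 1]`.

The resulting alternating sum over `c` satisfies a one-term recursion (`twistSum_succ`) and
collapses to `a ^ k` times a power of `q`: this is the framing factor of the curl. Hence the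
coloured HOMFLY-PT polynomial is `q ^ (k - 2k²) a ^ k [a; 0] ⋯ [a; k - 1] / [k]!` (`unknotValue`).

The continued fractions of `x` and `x - 1` differ only in their first entry, so `{x} = q² {x - 1} +
1` (`qRat_eq`) and `(q² - 1) {x} + 1 = q² δ_x`. At `a = q ν_x δ_x` one has `a² = q² δ_x`, and
pairing each of the `k` factors `a` with one bracket gives `a [a; i] = q ^ (i + 1) {x - i}`
(`aSpec_mul_aInt`). The product of these over `i < k` is the `q`-binomial coefficient, up to a power
of `q`. -/

namespace QWeb

/-! ### Partial closures, nested cups and caps, and rotations in a monoidal category -/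

section PartialTrace

universe v w

variable {C : Type w} [Category.{v} C] [MonoidalCategory C]

/-- Closing the rightmost strand `X` of `f` around the right with a cup `η` and a cap `ε`. -/
def ptr {X X' : C} (η : 𝟙_ C ⟶ X ⊗ X') (ε : X ⊗ X' ⟶ 𝟙_ C) {A B : C} (f : A ⊗ X ⟶ B ⊗ X) :
    A ⟶ B :=
  (ρ_ A).inv ≫ A ◁ η ≫ (α_ A X X').inv ≫ f ▷ X' ≫ (α_ B X X').hom ≫ B ◁ ε ≫ (ρ_ B).hom

/-- Closing the leftmost strand `X` of `f` around the left with a cup `η` and a cap `ε`. -/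
def ptl {X X' : C} (η : 𝟙_ C ⟶ X' ⊗ X) (ε : X' ⊗ X ⟶ 𝟙_ C) {A B : C} (f : X ⊗ A ⟶ X ⊗ B) :
    A ⟶ B :=
  (λ_ A).inv ≫ η ▷ A ≫ (α_ X' X A).hom ≫ X' ◁ f ≫ (α_ X' X B).inv ≫ ε ▷ B ≫ (λ_ B).hom

/-- The cup for `X ⊗ Y` obtained by nesting a cup for `Y` inside one for `X`, on the right. -/
def nestCupR {X Xd Y Yd : C} (η : 𝟙_ C ⟶ X ⊗ Xd) (θ : 𝟙_ C ⟶ Y ⊗ Yd) :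
    𝟙_ C ⟶ (X ⊗ Y) ⊗ (Yd ⊗ Xd) :=
  η ≫ (ρ_ X).inv ▷ Xd ≫ (X ◁ θ) ▷ Xd ≫ (α_ X Y Yd).inv ▷ Xd ≫ (α_ (X ⊗ Y) Yd Xd).hom

/-- The cap for `X ⊗ Y` obtained by nesting a cap for `Y` inside one for `X`, on the right. -/
def nestCapR {X Xd Y Yd : C} (ε : X ⊗ Xd ⟶ 𝟙_ C) (ζ : Y ⊗ Yd ⟶ 𝟙_ C) :
    (X ⊗ Y) ⊗ (Yd ⊗ Xd) ⟶ 𝟙_ C :=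
  (α_ (X ⊗ Y) Yd Xd).inv ≫ (α_ X Y Yd).hom ▷ Xd ≫ (X ◁ ζ) ▷ Xd ≫ (ρ_ X).hom ▷ Xd ≫ ε

/-- The cup for `X ⊗ Y` obtained by nesting a cup for `X` inside one for `Y`, on the left. -/
def nestCupL {X X' Y Y' : C} (η : 𝟙_ C ⟶ X' ⊗ X) (θ : 𝟙_ C ⟶ Y' ⊗ Y) :
    𝟙_ C ⟶ (Y' ⊗ X') ⊗ (X ⊗ Y) :=
  θ ≫ (ρ_ Y').inv ▷ Y ≫ (Y' ◁ η) ▷ Y ≫ (α_ Y' X' X).inv ▷ Y ≫ (α_ (Y' ⊗ X') X Y).hom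

/-- The cap for `X ⊗ Y` obtained by nesting a cap for `X` inside one for `Y`, on the left. -/
def nestCapL {X X' Y Y' : C} (ε : X' ⊗ X ⟶ 𝟙_ C) (ζ : Y' ⊗ Y ⟶ 𝟙_ C) :
    (Y' ⊗ X') ⊗ (X ⊗ Y) ⟶ 𝟙_ C :=
  (α_ (Y' ⊗ X') X Y).inv ≫ (α_ Y' X' X).hom ▷ Y ≫ (Y' ◁ ε) ▷ Y ≫ (ρ_ Y').hom ▷ Y ≫ ζ

section

variable {X X' Y Y' : C} (η : 𝟙_ C ⟶ X ⊗ X') (ε : X ⊗ X' ⟶ 𝟙_ C)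
  (θ : 𝟙_ C ⟶ Y ⊗ Y') (ζ : Y ⊗ Y' ⟶ 𝟙_ C)

/-- Naturality of the closure. Coherence is left to `monoidal`; the only geometric step is the
interchange of `g` with the cup. -/
theorem ptr_whiskerRight_comp {A A' B : C} (g : A' ⟶ A) (f : A ⊗ X ⟶ B ⊗ X) :
    ptr η ε (g ▷ X ≫ f) = g ≫ ptr η ε f := by
  calc ptr η ε (g ▷ X ≫ f) =
      (ρ_ A').inv ≫ A' ◁ η ≫ g ▷ (X ⊗ X') ≫ (α_ A X X').inv ≫ f ▷ X' ≫
        (α_ B X X').hom ≫ B ◁ ε ≫ (ρ_ B).hom := by rw [ptr]; monoidal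
    _ = g ≫ ptr η ε f := by rw [whisker_exchange_assoc, ptr]; monoidal

theorem ptr_comp_whiskerRight {A B B' : C} (f : A ⊗ X ⟶ B ⊗ X) (g : B ⟶ B') :
    ptr η ε (f ≫ g ▷ X) = ptr η ε f ≫ g := by
  calc ptr η ε (f ≫ g ▷ X) =
      (ρ_ A).inv ≫ A ◁ η ≫ (α_ A X X').inv ≫ f ▷ X' ≫
        (α_ B X X').hom ≫ g ▷ (X ⊗ X') ≫ B' ◁ ε ≫ (ρ_ B').hom := by rw [ptr]; monoidal
    _ = ptr η ε f ≫ g := by rw [← whisker_exchange_assoc, ptr]; monoidal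

theorem ptr_whiskerLeft {A B : C} (D : C) (f : A ⊗ X ⟶ B ⊗ X) :
    ptr η ε ((α_ D A X).hom ≫ D ◁ f ≫ (α_ D B X).inv) = D ◁ ptr η ε f := by
  rw [ptr, ptr]; monoidal

/-- Closing two parallel strands with nested arcs can be done one strand at a time, the rightmost
first. -/
theorem ptr_nest {A B : C} (f : A ⊗ (X ⊗ Y) ⟶ B ⊗ (X ⊗ Y)) :
    ptr (nestCupR η θ) (nestCapR ε ζ) f =
      ptr η ε (ptr θ ζ ((α_ A X Y).hom ≫ f ≫ (α_ B X Y).inv)) := by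
  simp only [ptr, nestCupR, nestCapR]; monoidal

/-- The morphism `h` travels along the closing arc: the cap turns it into `h'` on the return strand,
`h'` passes `f` by interchange, and the cup turns it back into `h`, now below `f`. -/
theorem ptr_cyclic {h : X ⟶ Y} {h' : Y' ⟶ X'} (hη : η ≫ h ▷ X' = θ ≫ Y ◁ h')
    (hε : X ◁ h' ≫ ε = h ▷ Y' ≫ ζ) {A B : C} (f : A ⊗ Y ⟶ B ⊗ X) :
    ptr θ ζ (f ≫ B ◁ h) = ptr η ε (A ◁ h ≫ f) := by
  calc ptr θ ζ (f ≫ B ◁ h) =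
      (ρ_ A).inv ≫ A ◁ θ ≫ (α_ A Y Y').inv ≫ f ▷ Y' ≫ (α_ B X Y').hom ≫
        B ◁ (h ▷ Y' ≫ ζ) ≫ (ρ_ B).hom := by rw [ptr]; monoidal
    _ = (ρ_ A).inv ≫ A ◁ θ ≫ (α_ A Y Y').inv ≫ (f ▷ Y' ≫ (B ⊗ X) ◁ h') ≫
        (α_ B X X').hom ≫ B ◁ ε ≫ (ρ_ B).hom := by rw [← hε]; monoidal
    _ = (ρ_ A).inv ≫ A ◁ (θ ≫ Y ◁ h') ≫ (α_ A Y X').inv ≫ f ▷ X' ≫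
        (α_ B X X').hom ≫ B ◁ ε ≫ (ρ_ B).hom := by rw [← whisker_exchange]; monoidal
    _ = ptr η ε (A ◁ h ≫ f) := by rw [← hη, ptr]; monoidal

end

section

variable {X X' Y Y' : C} (η : 𝟙_ C ⟶ X' ⊗ X) (ε : X' ⊗ X ⟶ 𝟙_ C)
  (θ : 𝟙_ C ⟶ Y' ⊗ Y) (ζ : Y' ⊗ Y ⟶ 𝟙_ C)

theorem ptl_comp_whiskerLeft {A A' B B' : C} (g : A' ⟶ A) (f : X ⊗ A ⟶ X ⊗ B) (h : B ⟶ B') :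
    ptl η ε (X ◁ g ≫ f ≫ X ◁ h) = g ≫ ptl η ε f ≫ h := by
  calc ptl η ε (X ◁ g ≫ f ≫ X ◁ h) =
      (λ_ A').inv ≫ η ▷ A' ≫ (X' ⊗ X) ◁ g ≫ (α_ X' X A).hom ≫ X' ◁ f ≫
        (α_ X' X B).inv ≫ (X' ⊗ X) ◁ h ≫ ε ▷ B' ≫ (λ_ B').hom := by rw [ptl]; monoidal
    _ = g ≫ ptl η ε f ≫ h := by
      rw [whisker_exchange_assoc, ← whisker_exchange_assoc, ptl]; monoidal

theorem ptl_whiskerRight {A B : C} (f : X ⊗ A ⟶ X ⊗ B) (D : C) :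
    ptl η ε ((α_ X A D).inv ≫ f ▷ D ≫ (α_ X B D).hom) = ptl η ε f ▷ D := by
  rw [ptl, ptl]; monoidal

theorem nestCupL_comp_nestCapL (f : X ⊗ Y ⟶ X ⊗ Y) :
    nestCupL η θ ≫ (Y' ⊗ X') ◁ f ≫ nestCapL ε ζ = θ ≫ Y' ◁ ptl η ε f ≫ ζ := by
  simp only [ptl, nestCupL, nestCapL]; monoidal

/-- Cyclicity of the full left closure, where the mate `h'` of `h` runs down the return strand. -/
theorem closure_cyclic {h : X ⟶ Y} {h' : Y' ⟶ X'} (hη : η ≫ X' ◁ h = θ ≫ h' ▷ Y)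
    (hε : h' ▷ X ≫ ε = Y' ◁ h ≫ ζ) (f : Y ⟶ X) :
    θ ≫ Y' ◁ (f ≫ h) ≫ ζ = η ≫ X' ◁ (h ≫ f) ≫ ε := by
  rw [MonoidalCategory.whiskerLeft_comp, Category.assoc, ← hε, whisker_exchange_assoc,
    ← reassoc_of% hη, MonoidalCategory.whiskerLeft_comp, Category.assoc]

end

section

variable {X X' Y Y' : C} {η : 𝟙_ C ⟶ X ⊗ X'} {ε : X' ⊗ X ⟶ 𝟙_ C}
  {θ : 𝟙_ C ⟶ Y ⊗ Y'} {ζ : Y' ⊗ Y ⟶ 𝟙_ C}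

/-- Sliding `h` through a cup turns it into its rotation. -/
theorem cup_comp_rotR (hz : θ ▷ Y ≫ (α_ Y Y' Y).hom ≫ Y ◁ ζ = (λ_ Y).hom ≫ (ρ_ Y).inv)
    (h : X ⟶ Y) :
    η ≫ h ▷ X' = θ ≫ Y ◁ ((ρ_ Y').inv ≫ Y' ◁ (η ≫ h ▷ X') ≫ (α_ Y' Y X').inv ≫ ζ ▷ X' ≫
      (λ_ X').hom) := by
  symm
  calc _ = (ρ_ _).inv ≫ (θ ▷ 𝟙_ C ≫ (Y ⊗ Y') ◁ (η ≫ h ▷ X')) ≫ (α_ _ _ _).hom ≫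
        Y ◁ ((α_ Y' Y X').inv ≫ ζ ▷ X' ≫ (λ_ X').hom) := by monoidal
    -- Moving the cup `η`, with `h` on it, below `θ` lets `θ` and `ζ` meet in a zigzag on `Y`.
    _ = (λ_ _).inv ≫ 𝟙_ C ◁ (η ≫ h ▷ X') ≫ (α_ _ _ _).inv ≫
        (θ ▷ Y ≫ (α_ Y Y' Y).hom ≫ Y ◁ ζ) ▷ X' ≫ (ρ_ Y).hom ▷ X' := by
      rw [← whisker_exchange]; monoidal
    _ = _ := by rw [hz]; monoidal

/-- Sliding `h` through a cap turns it into its rotation. -/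
theorem rotR_comp_cap (hz : η ▷ X ≫ (α_ X X' X).hom ≫ X ◁ ε = (λ_ X).hom ≫ (ρ_ X).inv)
    (h : X ⟶ Y) :
    ((ρ_ Y').inv ≫ Y' ◁ (η ≫ h ▷ X') ≫ (α_ Y' Y X').inv ≫ ζ ▷ X' ≫ (λ_ X').hom) ▷ X ≫ ε =
      Y' ◁ h ≫ ζ := by
  calc _ = (ρ_ Y').inv ▷ X ≫ (Y' ◁ (η ≫ h ▷ X')) ▷ X ≫ (α_ _ _ _).hom ≫ Y' ◁ (α_ _ _ _).hom ≫
        (α_ _ _ _).inv ≫ (ζ ▷ (X' ⊗ X) ≫ 𝟙_ C ◁ ε) ≫ (λ_ _).hom := by monoidal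
    -- The cap `ε` is pulled down past `ζ`, and in the next step past `h`, until it meets `η`.
    _ = (ρ_ Y').inv ▷ X ≫ (α_ _ _ _).hom ≫ Y' ◁ (η ▷ X ≫ (α_ _ _ _).hom ≫
        (h ▷ (X' ⊗ X) ≫ Y ◁ ε)) ≫ (α_ _ _ _).inv ≫ ζ ▷ 𝟙_ C ≫ (λ_ _).hom := by
      rw [← whisker_exchange]; monoidal
    _ = (ρ_ Y').inv ▷ X ≫ (α_ _ _ _).hom ≫ Y' ◁ (η ▷ X ≫ (α_ _ _ _).hom ≫ X ◁ ε) ≫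
        Y' ◁ h ▷ 𝟙_ C ≫ (α_ _ _ _).inv ≫ ζ ▷ 𝟙_ C ≫ (λ_ _).hom := by
      rw [← whisker_exchange]; monoidal
    _ = _ := by rw [hz]; monoidal

/-- The zigzag identity for nested cups and caps. -/
theorem nest_zigzagR (hX : η ▷ X ≫ (α_ X X' X).hom ≫ X ◁ ε = (λ_ X).hom ≫ (ρ_ X).inv)
    (hY : θ ▷ Y ≫ (α_ Y Y' Y).hom ≫ Y ◁ ζ = (λ_ Y).hom ≫ (ρ_ Y).inv) :
    nestCupR η θ ▷ (X ⊗ Y) ≫ (α_ (X ⊗ Y) (Y' ⊗ X') (X ⊗ Y)).hom ≫ (X ⊗ Y) ◁ nestCapL ε ζ =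
      (λ_ (X ⊗ Y)).hom ≫ (ρ_ (X ⊗ Y)).inv := by
  calc _ = 𝟙 _ ⊗≫ η ▷ X ▷ Y ⊗≫ X ◁ (θ ▷ (X' ⊗ X) ≫ (Y ⊗ Y') ◁ ε) ▷ Y ⊗≫ (X ⊗ Y) ◁ ζ ⊗≫ 𝟙 _ := by
        simp only [nestCupR, nestCapL]; monoidal
    -- Exchanging `θ` with `ε` separates the diagram into a zigzag on `X` and a zigzag on `Y`.
    _ = 𝟙 _ ⊗≫ (η ▷ X ≫ (α_ X X' X).hom ≫ X ◁ ε) ▷ Y ⊗≫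
        X ◁ (θ ▷ Y ≫ (α_ Y Y' Y).hom ≫ Y ◁ ζ) ⊗≫ 𝟙 _ := by
      rw [← whisker_exchange]; monoidal
    _ = _ := by rw [hX, hY]; monoidal

end

section

variable {X X' Y Y' : C} {η : 𝟙_ C ⟶ X' ⊗ X} {ε : X ⊗ X' ⟶ 𝟙_ C}
  {θ : 𝟙_ C ⟶ Y' ⊗ Y} {ζ : Y ⊗ Y' ⟶ 𝟙_ C}

/-- Sliding `h` through a cup turns it into its rotation. -/
theorem cup_comp_rotL (hz : Y ◁ θ ≫ (α_ Y Y' Y).inv ≫ ζ ▷ Y = (ρ_ Y).hom ≫ (λ_ Y).inv)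
    (h : X ⟶ Y) :
    η ≫ X' ◁ h = θ ≫ ((λ_ Y').inv ≫ (η ≫ X' ◁ h) ▷ Y' ≫ (α_ X' Y Y').hom ≫ X' ◁ ζ ≫
      (ρ_ X').hom) ▷ Y := by
  symm
  calc _ = (λ_ _).inv ≫ (𝟙_ C ◁ θ ≫ (η ≫ X' ◁ h) ▷ (Y' ⊗ Y)) ≫ (α_ _ _ _).inv ≫
        ((α_ X' Y Y').hom ≫ X' ◁ ζ ≫ (ρ_ X').hom) ▷ Y := by monoidal
    _ = (ρ_ _).inv ≫ (η ≫ X' ◁ h) ▷ 𝟙_ C ≫ (α_ _ _ _).hom ≫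
        X' ◁ (Y ◁ θ ≫ (α_ Y Y' Y).inv ≫ ζ ▷ Y) ≫ X' ◁ (λ_ Y).hom := by
      rw [whisker_exchange]; monoidal
    _ = _ := by rw [hz]; monoidal

/-- Sliding `h` through a cap turns it into its rotation. -/
theorem rotL_comp_cap (hz : X ◁ η ≫ (α_ X X' X).inv ≫ ε ▷ X = (ρ_ X).hom ≫ (λ_ X).inv)
    (h : X ⟶ Y) :
    X ◁ ((λ_ Y').inv ≫ (η ≫ X' ◁ h) ▷ Y' ≫ (α_ X' Y Y').hom ≫ X' ◁ ζ ≫ (ρ_ X').hom) ≫ ε =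
      h ▷ Y' ≫ ζ := by
  calc _ = X ◁ (λ_ Y').inv ≫ X ◁ ((η ≫ X' ◁ h) ▷ Y') ≫ (α_ _ _ _).inv ≫ (α_ _ _ _).inv ▷ Y' ≫
        (α_ _ _ _).hom ≫ ((X ⊗ X') ◁ ζ ≫ ε ▷ 𝟙_ C) ≫ (λ_ _).hom := by monoidal
    _ = X ◁ (λ_ Y').inv ≫ (α_ _ _ _).inv ≫ (X ◁ η ≫ (α_ _ _ _).inv ≫
        ((X ⊗ X') ◁ h ≫ ε ▷ Y)) ▷ Y' ≫ (α_ _ _ _).hom ≫ 𝟙_ C ◁ ζ ≫ (λ_ _).hom := by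
      rw [whisker_exchange]; monoidal
    _ = X ◁ (λ_ Y').inv ≫ (α_ _ _ _).inv ≫ (X ◁ η ≫ (α_ _ _ _).inv ≫ ε ▷ X) ▷ Y' ≫
        (𝟙_ C ◁ h) ▷ Y' ≫ (α_ _ _ _).hom ≫ 𝟙_ C ◁ ζ ≫ (λ_ _).hom := by
      rw [whisker_exchange]; monoidal
    _ = _ := by rw [hz]; monoidal

/-- The zigzag identity for nested cups and caps. -/
theorem nest_zigzagL (hX : X ◁ η ≫ (α_ X X' X).inv ≫ ε ▷ X = (ρ_ X).hom ≫ (λ_ X).inv)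
    (hY : Y ◁ θ ≫ (α_ Y Y' Y).inv ≫ ζ ▷ Y = (ρ_ Y).hom ≫ (λ_ Y).inv) :
    (X ⊗ Y) ◁ nestCupL η θ ≫ (α_ (X ⊗ Y) (Y' ⊗ X') (X ⊗ Y)).inv ≫ nestCapR ε ζ ▷ (X ⊗ Y) =
      (ρ_ (X ⊗ Y)).hom ≫ (λ_ (X ⊗ Y)).inv := by
  calc _ = 𝟙 _ ⊗≫ X ◁ Y ◁ θ ⊗≫ X ◁ ((Y ⊗ Y') ◁ η ≫ ζ ▷ (X' ⊗ X)) ▷ Y ⊗≫ ε ▷ X ▷ Y ⊗≫ 𝟙 _ := by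
        simp only [nestCupL, nestCapR]; monoidal
    _ = 𝟙 _ ⊗≫ X ◁ (Y ◁ θ ≫ (α_ Y Y' Y).inv ≫ ζ ▷ Y) ⊗≫
        (X ◁ η ≫ (α_ X X' X).inv ≫ ε ▷ X) ▷ Y ⊗≫ 𝟙 _ := by
      rw [whisker_exchange]; monoidal
    _ = _ := by rw [hX, hY]; monoidal

end

/-- A figure eight is obtained by closing its crossing on the right and then on the left. -/
theorem figureEight {X X' Y Y' : C} (η : 𝟙_ C ⟶ X' ⊗ X) (ε : X' ⊗ X ⟶ 𝟙_ C)
    (θ : 𝟙_ C ⟶ Y ⊗ Y') (ζ : Y ⊗ Y' ⟶ 𝟙_ C) (f : X ⊗ Y ⟶ X ⊗ Y) :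
    (λ_ (𝟙_ C)).inv ≫ (η ⊗ₘ θ) ≫ (α_ X' X (Y ⊗ Y')).hom ≫ X' ◁ (α_ X Y Y').inv ≫
      X' ◁ f ▷ Y' ≫ X' ◁ (α_ X Y Y').hom ≫ (α_ X' X (Y ⊗ Y')).inv ≫ (ε ⊗ₘ ζ) ≫
      (λ_ (𝟙_ C)).hom = η ≫ X' ◁ ptr θ ζ f ≫ ε := by
  -- The two expansions put the left cup lowest and the left cap highest, so that the right closure
  -- is nested inside the left one.
  rw [MonoidalCategory.tensorHom_def, MonoidalCategory.tensorHom_def', ptr]; monoidal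

section

variable {S : Type u} [CommRing S] [Preadditive C] [Linear S C] [MonoidalPreadditive C]
  [MonoidalLinear S C]
  {X X' : C} (η : 𝟙_ C ⟶ X ⊗ X') (ε : X ⊗ X' ⟶ 𝟙_ C)
  (θ : 𝟙_ C ⟶ X' ⊗ X) (ζ : X' ⊗ X ⟶ 𝟙_ C) {A B : C}

/-- Closing on the right is linear. -/
def ptrLinear : ((A ⊗ X) ⟶ (B ⊗ X)) →ₗ[S] (A ⟶ B) where
  toFun f := ptr η ε f
  map_add' f g := by simp [ptr, MonoidalPreadditive.add_whiskerRight]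
  map_smul' r f := by simp [ptr, MonoidalLinear.smul_whiskerRight]

theorem ptrLinear_apply (f : A ⊗ X ⟶ B ⊗ X) : ptrLinear (S := S) η ε f = ptr η ε f := rfl

theorem ptr_id {r : S} (h : η ≫ ε = r • 𝟙 _) : ptr η ε (𝟙 (A ⊗ X)) = r • 𝟙 A := by
  calc ptr η ε (𝟙 (A ⊗ X)) = (ρ_ A).inv ≫ A ◁ (η ≫ ε) ≫ (ρ_ A).hom := by rw [ptr]; monoidal
    _ = _ := by rw [h]; simp [MonoidalLinear.whiskerLeft_smul]

/-- Closing on the left is linear. -/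
def ptlLinear : ((X ⊗ A) ⟶ (X ⊗ B)) →ₗ[S] (A ⟶ B) where
  toFun f := ptl θ ζ f
  map_add' f g := by simp [ptl, MonoidalPreadditive.whiskerLeft_add]
  map_smul' r f := by simp [ptl, MonoidalLinear.whiskerLeft_smul]

theorem ptlLinear_apply (f : X ⊗ A ⟶ X ⊗ B) : ptlLinear (S := S) θ ζ f = ptl θ ζ f := rfl

theorem ptl_id {r : S} (h : θ ≫ ζ = r • 𝟙 _) : ptl θ ζ (𝟙 (X ⊗ A)) = r • 𝟙 A := by
  calc ptl θ ζ (𝟙 (X ⊗ A)) = (λ_ A).inv ≫ (θ ≫ ζ) ▷ A ≫ (λ_ A).hom := by rw [ptl]; monoidal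
    _ = _ := by rw [h]; simp [MonoidalLinear.smul_whiskerRight]

end

end PartialTrace

noncomputable section

/-! ### The web generators and relations in categorical form -/

section Generators

variable {R : Type u} [CommRing R] [Algebra Kq R] (a : Rˣ)

/-- The upward arrow labelled `k` as an object of the web category. -/
def upW (k : ℕ) : Web R a := of a (Obj.up k)

/-- The downward arrow labelled `k` as an object of the web category. -/
def downW (k : ℕ) : Web R a := of a (Obj.up k).dual

/-- The merge vertex. -/
def mrg {k l m : ℕ} (h : k + l = m) : upW a k ⊗ upW a l ⟶ upW a m := mk a (PreHom.mer h)

/-- The split vertex. -/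
def splt {k l m : ℕ} (h : k + l = m) : upW a m ⟶ upW a k ⊗ upW a l := mk a (PreHom.spl h)

/-- The cup oriented leftwards. -/
def cupRW (k : ℕ) : 𝟙_ (Web R a) ⟶ upW a k ⊗ downW a k := mk a (PreHom.cupR (Obj.up k))

/-- The cup oriented rightwards. -/
def cupLW (k : ℕ) : 𝟙_ (Web R a) ⟶ downW a k ⊗ upW a k := mk a (PreHom.cupL (Obj.up k))

/-- The cap oriented rightwards. -/
def capRW (k : ℕ) : upW a k ⊗ downW a k ⟶ 𝟙_ (Web R a) := mk a (PreHom.capR (Obj.up k))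

/-- The cap oriented leftwards. -/
def capLW (k : ℕ) : downW a k ⊗ upW a k ⟶ 𝟙_ (Web R a) := mk a (PreHom.capL (Obj.up k))

variable {a}

theorem zigzagR (j : ℕ) :
    cupRW a (j + 1) ▷ upW a (j + 1) ≫ (α_ _ _ _).hom ≫ upW a (j + 1) ◁ capLW a (j + 1) =
      (λ_ _).hom ≫ (ρ_ _).inv :=
  mk_eq (PreHom.Rel.zigzag₁ j)

theorem zigzagL (j : ℕ) :
    upW a (j + 1) ◁ cupLW a (j + 1) ≫ (α_ _ _ _).inv ≫ capRW a (j + 1) ▷ upW a (j + 1) =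
      (ρ_ _).hom ≫ (λ_ _).inv :=
  mk_eq (PreHom.Rel.zigzag₄ j)

/-- Both half turns of a merge vertex agree. This is what allows one and the same rotated vertex to
be used at a cup and at a cap. -/
theorem rot_mrg {i j m : ℕ} (h : (i + 1) + (j + 1) = m + 1) :
    (ρ_ (downW a (m + 1))).inv ≫ downW a (m + 1) ◁
        (nestCupR (cupRW a (i + 1)) (cupRW a (j + 1)) ≫ mrg a h ▷ _) ≫ (α_ _ _ _).inv ≫
        capLW a (m + 1) ▷ _ ≫ (λ_ _).hom =
      (λ_ (downW a (m + 1))).inv ≫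
        (nestCupL (cupLW a (i + 1)) (cupLW a (j + 1)) ≫ _ ◁ mrg a h) ▷ downW a (m + 1) ≫
        (α_ _ _ _).hom ≫ _ ◁ capRW a (m + 1) ≫ (ρ_ _).hom :=
  mk_eq (PreHom.Rel.rot_merge i j m h)

theorem mrg_assoc {k l r s t m : ℕ} (h₁ : k + l = s) (h₂ : s + r = m) (h₃ : l + r = t)
    (h₄ : k + t = m) :
    mrg a h₁ ▷ upW a r ≫ mrg a h₂ = (α_ _ _ _).hom ≫ upW a k ◁ mrg a h₃ ≫ mrg a h₄ :=
  mk_eq (PreHom.Rel.mer_assoc h₁ h₂ h₃ h₄)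

theorem splt_assoc {k l r s t m : ℕ} (h₁ : k + l = s) (h₂ : s + r = m) (h₃ : l + r = t)
    (h₄ : k + t = m) :
    splt a h₂ ≫ splt a h₁ ▷ upW a r = splt a h₄ ≫ upW a k ◁ splt a h₃ ≫ (α_ _ _ _).inv :=
  mk_eq (PreHom.Rel.spl_assoc h₁ h₂ h₃ h₄)

theorem splt_mrg {k l m : ℕ} (h : k + l = m) :
    splt a h ≫ mrg a h =
      PreHom.sc R (q ^ (-(k * l : ℤ)) * qIntBinom (k + l) k) • 𝟙 (upW a m) :=
  mk_eq (PreHom.Rel.digon h)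

theorem circleR_one : cupRW a 1 ≫ capRW a 1 = PreHom.aInt a 0 • 𝟙 _ :=
  mk_eq PreHom.Rel.circleR

theorem circleL_one : cupLW a 1 ≫ capLW a 1 = PreHom.aInt a 0 • 𝟙 _ :=
  mk_eq PreHom.Rel.circleL

theorem ptr_dumbbell_one_one :
    ptr (cupRW a 1) (capRW a 1) (mrg a (rfl : 1 + 1 = 2) ≫ splt a rfl) =
      PreHom.aInt a 1 • 𝟙 (upW a 1) :=
  mk_eq PreHom.Rel.sideDigonR

theorem ptl_dumbbell_one_one :
    ptl (cupLW a 1) (capLW a 1) (mrg a (rfl : 1 + 1 = 2) ≫ splt a rfl) =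
      PreHom.aInt a 1 • 𝟙 (upW a 1) :=
  mk_eq PreHom.Rel.sideDigonL

theorem mrg_zero_left (l : ℕ) : mrg a (Nat.zero_add l) = (λ_ (upW a l)).hom := by
  -- `relabel` is a transport along an equation of labels; with `m` free, that equation can be
  -- eliminated and the transport becomes an identity.
  have h : ∀ m (h : 0 + l = m) (e : l = m),
      mrg a h = (λ_ (upW a l)).hom ≫ eqToHom (by rw [e]) := by
    rintro m h rfl
    exact mk_eq (.refl _)
  rw [h _ _ rfl]; exact Category.comp_id _

theorem splt_zero_left (l : ℕ) : splt a (Nat.zero_add l) = (λ_ (upW a l)).inv := by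
  have h : ∀ m (h : 0 + l = m) (e : m = l),
      splt a h = eqToHom (by rw [e]) ≫ (λ_ (upW a l)).inv := by
    rintro m h rfl
    exact mk_eq (.refl _)
  rw [h _ _ rfl]; exact Category.id_comp _

theorem mrg_zero_right (k : ℕ) : mrg a (Nat.add_zero k) = (ρ_ (upW a k)).hom := by
  cases k with
  | zero => exact (mrg_zero_left 0).trans unitors_equal
  | succ k => exact Category.comp_id (ρ_ (upW a (k + 1))).hom

theorem splt_zero_right (k : ℕ) : splt a (Nat.add_zero k) = (ρ_ (upW a k)).inv := by
  cases k with
  | zero => exact (splt_zero_left 0).trans unitors_inv_equal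
  | succ k => exact Category.id_comp (ρ_ (upW a (k + 1))).inv

theorem square_switch (k l : ℕ) :
    (splt a (rfl : k + 1 = k + 1) ▷ upW a (l + 1) ≫ (α_ _ _ _).hom ≫
        upW a k ◁ mrg a (by omega : 1 + (l + 1) = l + 2)) ≫
      upW a k ◁ splt a (by omega : 1 + (l + 1) = l + 2) ≫ (α_ _ _ _).inv ≫
        mrg a (rfl : k + 1 = k + 1) ▷ upW a (l + 1) =
    (upW a (k + 1) ◁ splt a (by omega : 1 + l = l + 1) ≫ (α_ _ _ _).inv ≫
        mrg a (rfl : k + 1 + 1 = k + 2) ▷ upW a l) ≫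
      splt a (rfl : k + 1 + 1 = k + 2) ▷ upW a l ≫ (α_ _ _ _).hom ≫
        upW a (k + 1) ◁ mrg a (by omega : 1 + l = l + 1) +
    PreHom.sc R (q ^ (1 - (k + 1) + (l + 1) : ℤ) * qInt ((k + 1) - (l + 1))) • 𝟙 _ :=
  mk_eq (PreHom.Rel.square k l)

end Generators

/-! ### Quantum integers, factorials and the brackets `[a; j]` -/

section Scalars

/-- The symmetric `q`-integer `(q^n - q^{-n}) / (q - q⁻¹)`. -/
def qSym (n : ℤ) : Kq := (q ^ n - q ^ (-n)) / (q - q⁻¹)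

theorem q_sq_sub_one_ne_zero : q ^ 2 - 1 ≠ 0 := sub_ne_zero.mpr (q_pow_ne_one two_ne_zero)

theorem qInt_eq (n : ℤ) : qInt n = q ^ (n - 1) * qSym n := by
  have h0 := q_ne_zero
  have h1 := q_sq_sub_one_ne_zero
  have h2 := q_sub_inv_ne_zero
  have e : q - q⁻¹ = (q ^ 2 - 1) / q := by field_simp
  rw [qInt, qSym, e, zpow_sub_one₀ h0, two_mul, zpow_add₀ h0, zpow_neg]
  have := zpow_ne_zero n h0
  field_simp

theorem qInt_one : qInt 1 = 1 := by
  rw [qInt]; exact div_self q_sq_sub_one_ne_zero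

/-- Its value at `q = 1` is `n`. -/
theorem qInt_ne_zero {n : ℤ} (hn : n ≠ 0) : qInt n ≠ 0 :=
  (hasValue_qInt n).ne_zero (by exact_mod_cast hn)

theorem qSym_ne_zero {n : ℤ} (hn : n ≠ 0) : qSym n ≠ 0 := by
  have := qInt_ne_zero hn
  rw [qInt_eq] at this
  exact right_ne_zero_of_mul this

theorem qSym_neg (n : ℤ) : qSym (-n) = -qSym n := by
  rw [qSym, qSym, neg_neg]; ring

theorem zpow_mul_qInt (n : ℤ) : q ^ (1 - n) * qInt n = qSym n := by
  rw [qInt_eq, ← mul_assoc, ← zpow_add₀ q_ne_zero, sub_add_sub_cancel, sub_self, zpow_zero,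
    one_mul]

/-- The numerator is `{k + 1} ⋯ {2}`, and the factor `{1} = 1` missing from `{k + 1}!` does not
matter. -/
theorem qIntBinom_succ_self (k : ℕ) : qIntBinom (k + 1) k = qInt (k + 1) := by
  have h : ∏ i ∈ Finset.range k, qInt (k + 1 - i) =
      ∏ i ∈ Finset.range k, qInt ((i + 1 : ℕ) + 1) := by
    rw [← Finset.prod_range_reflect]
    refine Finset.prod_congr rfl fun i hi => ?_
    have := Finset.mem_range.mp hi
    congr 1; omega
  have h' := Finset.prod_range_succ' (fun i : ℕ => qInt (i + 1)) k
  rw [Finset.prod_range_succ] at h'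
  rw [qIntBinom, h, div_eq_iff (Finset.prod_ne_zero_iff.mpr fun i _ => qInt_ne_zero (by omega))]
  simp only [Nat.cast_zero, zero_add, qInt_one, mul_one] at h'
  rw [← h', mul_comm]

theorem qIntBinom_one (n : ℤ) : qIntBinom n 1 = qInt n := by
  simp [qIntBinom, qInt_one]

theorem digon_succ_self (k : ℕ) :
    q ^ (-(k * (1 : ℕ) : ℤ)) * qIntBinom (k + (1 : ℕ)) k = qSym (k + 1) := by
  rw [Nat.cast_one, qIntBinom_succ_self, ← zpow_mul_qInt]; congr 2; ring

theorem digon_one (k : ℕ) :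
    q ^ (-((1 : ℕ) * k : ℤ)) * qIntBinom ((1 : ℕ) + k) 1 = qSym (k + 1) := by
  rw [qIntBinom_one, ← zpow_mul_qInt, Nat.cast_one, add_comm]; congr 2; ring

/-- The symmetric `q`-factorial. -/
def qSymFact (n : ℕ) : Kq := ∏ i ∈ Finset.range n, qSym (i + 1)

theorem qSymFact_zero : qSymFact 0 = 1 := Finset.prod_range_zero _

theorem qSymFact_succ (n : ℕ) : qSymFact (n + 1) = qSymFact n * qSym (n + 1) :=
  Finset.prod_range_succ _ _

theorem qSymFact_ne_zero (n : ℕ) : qSymFact n ≠ 0 :=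
  Finset.prod_ne_zero_iff.mpr fun i _ => qSym_ne_zero (by omega)

variable {R : Type u} [CommRing R] [Algebra Kq R]

theorem sc_mul (x y : Kq) : PreHom.sc R (x * y) = PreHom.sc R x * PreHom.sc R y := map_mul _ _ _

theorem sc_sub (x y : Kq) : PreHom.sc R (x - y) = PreHom.sc R x - PreHom.sc R y := map_sub _ _ _

theorem sc_neg (x : Kq) : PreHom.sc R (-x) = -PreHom.sc R x := map_neg _ _

theorem sc_one : PreHom.sc R 1 = 1 := map_one _

/-- `∏_{i < n} [a; s + i]`, where `[a; j]` is `(a q^{-j} - a⁻¹ q^j) / (q - q⁻¹)`. -/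
def aProd (a : Rˣ) (s n : ℕ) : R := ∏ i ∈ Finset.range n, PreHom.aInt a (s + i : ℕ)

/-- The quantum binomial coefficient `[a; s] ⋯ [a; s + n - 1] / [n]!`. -/
def aBinom (a : Rˣ) (s n : ℕ) : R := aProd a s n * PreHom.sc R (qSymFact n)⁻¹

theorem aProd_succ (a : Rˣ) (s n : ℕ) :
    aProd a s (n + 1) = aProd a s n * PreHom.aInt a (s + n : ℕ) :=
  Finset.prod_range_succ _ _

theorem aProd_succ' (a : Rˣ) (s n : ℕ) :
    aProd a s (n + 1) = PreHom.aInt a s * aProd a (s + 1) n := by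
  rw [aProd, Finset.prod_range_succ', mul_comm, aProd]
  congr 1
  exact Finset.prod_congr rfl fun i _ => by congr 2; omega

theorem aBinom_zero (a : Rˣ) (s : ℕ) : aBinom a s 0 = 1 := by
  simp [aBinom, aProd, qSymFact_zero, sc_one]

theorem aBinom_succ (a : Rˣ) (s n : ℕ) :
    aBinom a s (n + 1) =
      PreHom.sc R (qSym (n + 1))⁻¹ * (PreHom.aInt a (s + n : ℕ) * aBinom a s n) := by
  rw [aBinom, aBinom, aProd_succ, qSymFact_succ, mul_inv, sc_mul]; ring

theorem aBinom_one (a : Rˣ) (s : ℕ) : aBinom a s 1 = PreHom.aInt a s := by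
  have h : qSym ((0 : ℕ) + 1) = 1 := by
    rw [← zpow_mul_qInt]; simp [qInt_one]
  rw [show (1 : ℕ) = 0 + 1 from rfl, aBinom_succ, aBinom_zero, h]; simp [sc_one]

theorem qSym_succ_sub (k : ℤ) : q ^ (-1 : ℤ) * qSym (k + 1) - qSym k = q ^ (-(k + 1)) := by
  have h0 := q_ne_zero
  have h1 := q_sq_sub_one_ne_zero
  have e : q - q⁻¹ = (q ^ 2 - 1) / q := by field_simp
  rw [qSym, qSym, e, neg_add, zpow_add₀ h0, zpow_add₀ h0, zpow_neg, zpow_neg, zpow_one]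
  have := zpow_ne_zero k h0
  field_simp
  ring

theorem qSym_succ_sub' (k : ℤ) : q ^ (1 : ℤ) * qSym (k + 1) - qSym k = q ^ (k + 1) := by
  have h0 := q_ne_zero
  have h1 := q_sq_sub_one_ne_zero
  have e : q - q⁻¹ = (q ^ 2 - 1) / q := by field_simp
  rw [qSym, qSym, e, neg_add, zpow_add₀ h0, zpow_add₀ h0, zpow_neg, zpow_neg, zpow_one]
  have := zpow_ne_zero k h0
  field_simp
  ring

/-- Comparing coefficients of `a` and of `a⁻¹` leaves the two identities `q^{∓1} [k + 1] - [k] =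
q^{∓(k + 1)}`. The right-hand side is the combination that the square switch produces when an edge
labelled `1` is closed. -/
theorem aInt_succ (a : Rˣ) (k : ℤ) :
    PreHom.aInt a (k + 1) =
      PreHom.sc R (qSym (k + 1)) * PreHom.aInt a 1 - PreHom.sc R (qSym k) * PreHom.aInt a 0 := by
  have h1 := congrArg (PreHom.sc R) (qSym_succ_sub k)
  have h2 := congrArg (PreHom.sc R) (qSym_succ_sub' k)
  rw [sc_sub, sc_mul] at h1 h2
  simp only [PreHom.aInt, ← h1, ← h2, neg_zero, zpow_zero, sc_one]
  ring

end Scalars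

/-! ### Erased edges: cups, caps and ladders with a unit object -/

section NestUnit

universe v w

variable {C : Type w} [Category.{v} C] [MonoidalCategory C] {X X' : C}

theorem nestCupR_unit_left (η : 𝟙_ C ⟶ X ⊗ X') :
    nestCupR (λ_ (𝟙_ C)).inv η ≫ (λ_ X).hom ▷ (X' ⊗ 𝟙_ C) = η ≫ X ◁ (ρ_ X').inv := by
  rw [nestCupR]; monoidal

theorem nestCapR_unit_left (ε : X ⊗ X' ⟶ 𝟙_ C) :
    (𝟙_ C ⊗ X) ◁ (ρ_ X').inv ≫ nestCapR (λ_ (𝟙_ C)).hom ε = (λ_ X).hom ▷ X' ≫ ε := by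
  rw [nestCapR]; monoidal

theorem nestCupR_unit_right (η : 𝟙_ C ⟶ X ⊗ X') :
    nestCupR η (λ_ (𝟙_ C)).inv ≫ (ρ_ X).hom ▷ (𝟙_ C ⊗ X') = η ≫ X ◁ (λ_ X').inv := by
  rw [nestCupR]; monoidal

theorem nestCapR_unit_right (ε : X ⊗ X' ⟶ 𝟙_ C) :
    (X ⊗ 𝟙_ C) ◁ (λ_ X').inv ≫ nestCapR ε (λ_ (𝟙_ C)).hom = (ρ_ X).hom ▷ X' ≫ ε := by
  rw [nestCapR]; monoidal

theorem ptr_unit (A : C) :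
    ptr (λ_ (𝟙_ C)).inv (λ_ (𝟙_ C)).hom ((ρ_ A).hom ≫ (ρ_ A).inv) = 𝟙 A := by
  rw [ptr]; monoidal

/-- One side of the square switch when the right upright is erased between the rungs: only a
dumbbell remains. -/
theorem ladder_unit_right {A B D : C} (f : A ⊗ B ⟶ D) (g : D ⟶ A ⊗ B) :
    (A ◁ (ρ_ B).inv ≫ (α_ _ _ _).inv ≫ f ▷ 𝟙_ C) ≫ g ▷ 𝟙_ C ≫ (α_ _ _ _).hom ≫ A ◁ (ρ_ B).hom =
      f ≫ g := by
  monoidal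

theorem ladder_unit_left {A B D : C} (f : A ⊗ B ⟶ D) (g : D ⟶ A ⊗ B) :
    ((λ_ A).inv ▷ B ≫ (α_ _ _ _).hom ≫ 𝟙_ C ◁ f) ≫ 𝟙_ C ◁ g ≫ (α_ _ _ _).inv ≫ (λ_ A).hom ▷ B =
      f ≫ g := by
  monoidal

end NestUnit

/-! ### Closing dumbbells, ladders and the crossing -/

section Closures

variable {R : Type u} [CommRing R] [Algebra Kq R] {a : Rˣ}

/-- A merge vertex can be slid around the right. -/
theorem exists_rot_mrg {k l m : ℕ} (h : k + l = m) :
    ∃ h' : downW a m ⟶ downW a l ⊗ downW a k,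
      nestCupR (cupRW a k) (cupRW a l) ≫ mrg a h ▷ (downW a l ⊗ downW a k) =
        cupRW a m ≫ upW a m ◁ h' ∧
      (upW a k ⊗ upW a l) ◁ h' ≫ nestCapR (capRW a k) (capRW a l) =
        mrg a h ▷ downW a m ≫ capRW a m := by
  match k, l, m, h with
  | 0, l, m, h =>
    obtain rfl : l = m := by omega
    rw [show mrg a h = _ from mrg_zero_left l]
    exact ⟨(ρ_ (downW a l)).inv, nestCupR_unit_left (cupRW a l), nestCapR_unit_left (capRW a l)⟩
  | k + 1, 0, m, h =>
    obtain rfl : k + 1 = m := by omega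
    rw [show mrg a h = _ from mrg_zero_right (k + 1)]
    exact ⟨(λ_ (downW a (k + 1))).inv, nestCupR_unit_right (cupRW a (k + 1)),
      nestCapR_unit_right (capRW a (k + 1))⟩
  | k + 1, l + 1, m + 1, h =>
    -- The cup yields the counterclockwise rotation as witness, while the cap needs the clockwise
    -- one; `rot_mrg` identifies them.
    refine ⟨_, cup_comp_rotR (zigzagR m) (mrg a h), ?_⟩
    rw [rot_mrg h]
    exact rotL_comp_cap (nest_zigzagL (zigzagL k) (zigzagL l)) (mrg a h)

/-- Sliding the top merge around the right replaces one closed strand `m` by two closed strands `k`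
and `l`, to be closed successively. -/
theorem ptr_mrg_cyclic {k l m : ℕ} (h : k + l = m) {A B : Web R a}
    (f : A ⊗ upW a m ⟶ B ⊗ (upW a k ⊗ upW a l)) :
    ptr (cupRW a m) (capRW a m) (f ≫ B ◁ mrg a h) =
      ptr (cupRW a k) (capRW a k) (ptr (cupRW a l) (capRW a l)
        ((α_ _ _ _).hom ≫ (A ◁ mrg a h ≫ f) ≫ (α_ _ _ _).inv)) := by
  obtain ⟨h', h₁, h₂⟩ := exists_rot_mrg (a := a) h
  rw [ptr_cyclic _ _ _ _ h₁ h₂, ptr_nest]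

theorem closure_mrg_cyclic {k l m : ℕ} (h : (k + 1) + (l + 1) = m + 1)
    (f : upW a (m + 1) ⟶ upW a (k + 1) ⊗ upW a (l + 1)) :
    cupLW a (m + 1) ≫ downW a (m + 1) ◁ (f ≫ mrg a h) ≫ capLW a (m + 1) =
      cupLW a (l + 1) ≫ downW a (l + 1) ◁
        ptl (cupLW a (k + 1)) (capLW a (k + 1)) (mrg a h ≫ f) ≫ capLW a (l + 1) := by
  rw [← nestCupL_comp_nestCapL]
  refine closure_cyclic _ _ _ _ (cup_comp_rotL (zigzagL m) (mrg a h)) ?_ f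
  rw [← rot_mrg h]
  exact rotR_comp_cap (nest_zigzagR (zigzagR k) (zigzagR l)) (mrg a h)

theorem ptr_smul {k : ℕ} {A B : Web R a} (r : R) (f : A ⊗ upW a k ⟶ B ⊗ upW a k) :
    ptr (cupRW a k) (capRW a k) (r • f) = r • ptr (cupRW a k) (capRW a k) f :=
  (ptrLinear (S := R) (cupRW a k) (capRW a k)).map_smul r f

/-- The square switch on uprights `k + 1` and `1` writes the dumbbell as a ladder minus `[k]` times
the identity. The ladder contains a dumbbell on two edges `1`, whose closure is a relation, and a
digon worth `[k + 1]` remains; the identity closes to a circle. `aInt_succ` adds up the two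
contributions. -/
theorem ptr_dumbbell_one (k : ℕ) :
    ptr (cupRW a 1) (capRW a 1) (mrg a (rfl : k + 1 = k + 1) ≫ splt a rfl) =
      PreHom.aInt a k • 𝟙 (upW a k) := by
  cases k with
  | zero =>
    -- With the left edge erased, the dumbbell is an identity strand and its closure a circle.
    rw [show mrg a (rfl : 0 + 1 = 0 + 1) = _ from mrg_zero_left 1,
      show splt a (rfl : 0 + 1 = 0 + 1) = _ from splt_zero_left 1]
    have e : (λ_ (upW a 1)).hom ≫ (λ_ (upW a 1)).inv = 𝟙 (upW a 0 ⊗ upW a 1) :=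
      Iso.hom_inv_id _
    refine (congrArg _ e).trans ?_
    exact ptr_id _ _ circleR_one
  | succ k =>
    have h := square_switch (a := a) k 0
    rw [show mrg a (by omega : 1 + 0 = 0 + 1) = _ from mrg_zero_right 1,
      show splt a (by omega : 1 + 0 = 0 + 1) = _ from splt_zero_right 1] at h
    have e := ladder_unit_right (mrg a (rfl : k + 1 + 1 = k + 2)) (splt a rfl)
    have h2 : _ = _ + _ := h.trans (congrArg (· + _) e)
    have h3 := (sub_eq_iff_eq_add.mpr h2).symm
    refine (congrArg _ h3).trans ?_
    rw [← ptrLinear_apply (S := R), map_sub, map_smul, ptrLinear_apply, ptrLinear_apply,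
      ptr_id _ _ circleR_one]
    have e2 : (splt a (rfl : k + 1 = k + 1) ▷ upW a 1 ≫ (α_ _ _ _).hom ≫
        upW a k ◁ mrg a (by omega : 1 + 1 = 2)) ≫
      upW a k ◁ splt a (by omega : 1 + 1 = 2) ≫ (α_ _ _ _).inv ≫
        mrg a (rfl : k + 1 = k + 1) ▷ upW a 1 =
      splt a (rfl : k + 1 = k + 1) ▷ upW a 1 ≫ ((α_ _ _ _).hom ≫
        upW a k ◁ (mrg a (rfl : 1 + 1 = 2) ≫ splt a rfl) ≫ (α_ _ _ _).inv) ≫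
        mrg a (rfl : k + 1 = k + 1) ▷ upW a 1 := by
      rw [MonoidalCategory.whiskerLeft_comp]; simp only [Category.assoc]
    rw [show ptr (cupRW a 1) (capRW a 1) _ = _ from congrArg _ e2, ptr_whiskerRight_comp,
      ptr_comp_whiskerRight, ptr_whiskerLeft, ptr_dumbbell_one_one,
      MonoidalLinear.whiskerLeft_smul, MonoidalCategory.whiskerLeft_id, Linear.smul_comp,
      Category.id_comp, Linear.comp_smul, splt_mrg, digon_succ_self, smul_smul, smul_smul,
      ← sub_smul, Nat.cast_succ, aInt_succ]
    congr 2
    · ring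
    · rw [← zpow_mul_qInt]
      congr 3 <;> push_cast <;> ring_nf

/-- The mirror argument, with the square switch on uprights `1` and `k + 1`. Only left closures of
an edge `1` are needed, since circles are peeled off one unit at a time. -/
theorem ptl_dumbbell_one (k : ℕ) :
    ptl (cupLW a 1) (capLW a 1)
        (mrg a (by omega : 1 + (k + 1) = k + 2) ≫ splt a (by omega : 1 + (k + 1) = k + 2)) =
      PreHom.aInt a (k + 1 : ℕ) • 𝟙 (upW a (k + 1)) := by
  have h := square_switch (a := a) 0 k
  rw [show mrg a (rfl : 0 + 1 = 0 + 1) = _ from mrg_zero_left 1,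
    show splt a (rfl : 0 + 1 = 0 + 1) = _ from splt_zero_left 1] at h
  have e := ladder_unit_left (mrg a (by omega : 1 + (k + 1) = k + 2)) (splt a (by omega))
  have h3 := e.symm.trans h
  refine (congrArg _ h3).trans ?_
  have e2 : (upW a (0 + 1) ◁ splt a (by omega : 1 + k = k + 1) ≫ (α_ _ _ _).inv ≫
        mrg a (rfl : 0 + 1 + 1 = 0 + 2) ▷ upW a k) ≫
      splt a (rfl : 0 + 1 + 1 = 0 + 2) ▷ upW a k ≫ (α_ _ _ _).hom ≫
        upW a (0 + 1) ◁ mrg a (by omega : 1 + k = k + 1) =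
      upW a 1 ◁ splt a (by omega : 1 + k = k + 1) ≫ ((α_ _ _ _).inv ≫
        (mrg a (rfl : 1 + 1 = 2) ≫ splt a rfl) ▷ upW a k ≫ (α_ _ _ _).hom) ≫
        upW a 1 ◁ mrg a (by omega : 1 + k = k + 1) := by
    rw [comp_whiskerRight]; simp only [Category.assoc]
  rw [e2, ← ptlLinear_apply (S := R), map_add, map_smul, ptlLinear_apply, ptlLinear_apply,
    ptl_id _ _ circleL_one, ptl_comp_whiskerLeft, ptl_whiskerRight, ptl_dumbbell_one_one,
    MonoidalLinear.smul_whiskerRight, MonoidalCategory.id_whiskerRight, Linear.smul_comp,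
    Category.id_comp, Linear.comp_smul, splt_mrg, digon_one, smul_smul, smul_smul,
    ← add_smul, Nat.cast_succ, aInt_succ]
  -- Here the dumbbell is on the other side of the square switch, so the identity enters with a plus
  -- sign; its coefficient is `[-k] = -[k]`, which gives the same combination as on the right.
  have e3 : q ^ (1 - ((0 : ℕ) + 1) + (k + 1) : ℤ) * qInt (((0 : ℕ) + 1) - (k + 1)) = -qSym k := by
    rw [← qSym_neg, ← zpow_mul_qInt]; congr 2 <;> push_cast <;> ring
  rw [e3, sc_neg]
  congr 1
  ring

/-- Induction on the closed label. A digon on the edge `l + 1` costs `[l + 1]`; sliding its merge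
around and using associativity and coassociativity gives a dumbbell on `k + l` and `1` inside one on
`k` and `l`. Closing the strand `1` contributes `[a; k + l]`. -/
theorem ptr_dumbbell {k l m : ℕ} (h : k + l = m) :
    ptr (cupRW a l) (capRW a l) (mrg a h ≫ splt a h) = aBinom a k l • 𝟙 (upW a k) := by
  induction l generalizing m with
  | zero =>
    obtain rfl : k = m := by omega
    rw [show mrg a h = _ from mrg_zero_right k, show splt a h = _ from splt_zero_right k,
      aBinom_zero, one_smul]
    exact ptr_unit (upW a k)
  | succ l ih =>
    obtain rfl : k + l + 1 = m := by omega
    have h1 : (mrg a h ≫ splt a h) ≫ upW a k ◁ (splt a (rfl : l + 1 = l + 1) ≫ mrg a rfl) =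
        PreHom.sc R (qSym (l + 1)) • (mrg a h ≫ splt a h) := by
      rw [splt_mrg, digon_succ_self, MonoidalLinear.whiskerLeft_smul,
        MonoidalCategory.whiskerLeft_id, Linear.comp_smul, Category.comp_id]
    have h2 : (α_ (upW a k) (upW a l) (upW a 1)).hom ≫ (upW a k ◁ mrg a (rfl : l + 1 = l + 1) ≫
        (mrg a h ≫ splt a h) ≫ upW a k ◁ splt a rfl) ≫ (α_ _ _ _).inv =
        mrg a (rfl : k + l = k + l) ▷ upW a 1 ≫ (mrg a rfl ≫ splt a rfl) ≫
          splt a (rfl : k + l = k + l) ▷ upW a 1 := by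
      simp only [Category.assoc]
      rw [splt_assoc rfl rfl (rfl : l + 1 = l + 1) h,
        reassoc_of% (mrg_assoc (a := a) rfl rfl (rfl : l + 1 = l + 1) h)]
    have h3 := congrArg (ptr (cupRW a (l + 1)) (capRW a (l + 1))) h1
    rw [ptr_smul, MonoidalCategory.whiskerLeft_comp, ← Category.assoc, ptr_mrg_cyclic, h2,
      ptr_whiskerRight_comp, ptr_comp_whiskerRight, ptr_dumbbell_one, Linear.smul_comp,
      Category.id_comp, Linear.comp_smul, ptr_smul, ih] at h3
    rw [aBinom_succ, mul_smul, mul_smul, h3, smul_smul, ← sc_mul,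
      inv_mul_cancel₀ (qSym_ne_zero (by omega)), sc_one, one_smul]

/-- A digon with edges `1` and `k + 1` on a circle `k + 2` multiplies it by `[k + 2]`. Sliding the
merge around and closing the edge `1` on the left leaves `[a; k + 1]` times a circle `k + 1`. -/
theorem circleL (k : ℕ) :
    cupLW a (k + 1) ≫ capLW a (k + 1) = aBinom a 0 (k + 1) • 𝟙 (𝟙_ (Web R a)) := by
  induction k with
  | zero => rw [aBinom_one]; exact circleL_one
  | succ k ih =>
    have h := closure_mrg_cyclic (a := a) (k := 0) (l := k) (m := k + 1) (by omega)
      (splt a (by omega))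
    rw [splt_mrg, show ptl _ _ _ = _ from ptl_dumbbell_one k] at h
    simp only [MonoidalLinear.whiskerLeft_smul, MonoidalCategory.whiskerLeft_id, Linear.smul_comp,
      Linear.comp_smul, Category.id_comp, ih] at h
    rw [show ((0 + 1 : ℕ) : ℤ) = (1 : ℕ) from rfl, show (0 + 1 : ℕ) = 1 from rfl, digon_one] at h
    rw [aBinom_succ, mul_smul, zero_add, mul_smul, ← h, smul_smul, ← sc_mul,
      inv_mul_cancel₀ (qSym_ne_zero (by omega)), sc_one, one_smul]

/-- Closing a ladder with two opposite rungs around the right. -/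
theorem ptr_ladder {k c j m : ℕ} (h : k + c = m) (h' : c + j = k) :
    ptr (cupRW a k) (capRW a k)
      ((upW a k ◁ splt a h' ≫ (α_ _ _ _).inv ≫ mrg a h ▷ upW a j) ≫
        splt a h ▷ upW a j ≫ (α_ _ _ _).hom ≫ upW a k ◁ mrg a h') =
      (aBinom a c j * aBinom a k c) • 𝟙 (upW a k) := by
  -- After the top merge has slid to the bottom, the ladder becomes a dumbbell on `c` and `j`
  -- followed by one on `k` and `c`. The strands `j` and `c` are then closed in this order.
  have e : (α_ (upW a k) (upW a c) (upW a j)).hom ≫ (upW a k ◁ mrg a h' ≫ upW a k ◁ splt a h' ≫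
      (α_ _ _ _).inv ≫ mrg a h ▷ upW a j ≫ splt a h ▷ upW a j ≫ (α_ _ _ _).hom) ≫
      (α_ _ _ _).inv = ((α_ _ _ _).hom ≫ upW a k ◁ (mrg a h' ≫ splt a h') ≫ (α_ _ _ _).inv) ≫
        (mrg a h ≫ splt a h) ▷ upW a j := by
    simp
  have e' := ptr_mrg_cyclic h' (upW a k ◁ splt a h' ≫ (α_ _ _ _).inv ≫ mrg a h ▷ upW a j ≫
    splt a h ▷ upW a j ≫ (α_ _ _ _).hom)
  rw [e, ptr_comp_whiskerRight, ptr_whiskerLeft, ptr_dumbbell, MonoidalLinear.whiskerLeft_smul,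
    MonoidalCategory.whiskerLeft_id, Linear.smul_comp, Category.id_comp, ptr_smul,
    ptr_dumbbell, smul_smul] at e'
  rw [← e']
  simp only [Category.assoc]

variable (a) in
/-- The crossing of two upward strands labelled `k`. -/
def crossW (k : ℕ) : upW a k ⊗ upW a k ⟶ upW a k ⊗ upW a k := braidingInv a k k

variable (a) in
/-- The ladders occurring in the expansion of `crossW`. -/
def ladderW {k c j m : ℕ} (h : k + c = m) (h' : c + j = k) :
    upW a k ⊗ upW a k ⟶ upW a k ⊗ upW a k :=
  (upW a k ◁ splt a h' ≫ (α_ _ _ _).inv ≫ mrg a h ▷ upW a j) ≫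
    splt a h ▷ upW a j ≫ (α_ _ _ _).hom ≫ upW a k ◁ mrg a h'

theorem crossW_eq (k : ℕ) :
    crossW a k = PreHom.sc R ((-q) ^ (-(k * k : ℤ))) • ∑ j : Fin (min k k + 1),
      PreHom.sc R ((-q) ^ (j : ℕ)) •
        ladderW a (by omega : k + (k - j) = k + k - j) (by omega : k - j + j = k) := rfl

theorem ptr_crossW (k : ℕ) :
    ptr (cupRW a k) (capRW a k) (crossW a k) =
      (PreHom.sc R ((-q) ^ (-(k * k : ℤ))) * ∑ j ∈ Finset.range (k + 1),
        PreHom.sc R ((-q) ^ j) * (aBinom a (k - j) j * aBinom a k (k - j))) • 𝟙 (upW a k) := by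
  have e : ∑ j ∈ Finset.range (k + 1),
      PreHom.sc R ((-q) ^ j) * (aBinom a (k - j) j * aBinom a k (k - j)) =
      ∑ j : Fin (min k k + 1),
        PreHom.sc R ((-q) ^ (j : ℕ)) * (aBinom a (k - j) j * aBinom a k (k - j)) := by
    rw [Fin.sum_univ_eq_sum_range
      (fun j => PreHom.sc R ((-q) ^ j) * (aBinom a (k - j) j * aBinom a k (k - j))), min_self]
  rw [e, crossW_eq, ptr_smul, mul_smul, Finset.sum_smul, ← ptrLinear_apply (S := R), map_sum]
  congr 1
  refine Finset.sum_congr rfl fun j _ => ?_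
  rw [map_smul, ptrLinear_apply, ladderW, ptr_ladder, smul_smul]

theorem hasLinkValue_stabilizedUnknot (k : ℕ) :
    HasLinkValue a (stabilizedUnknot (k + 1))
      (PreHom.sc R ((-q) ^ (-((k + 1 : ℕ) * (k + 1 : ℕ) : ℤ))) * (∑ j ∈ Finset.range (k + 1 + 1),
        PreHom.sc R ((-q) ^ j) * (aBinom a (k + 1 - j) j * aBinom a (k + 1) (k + 1 - j))) *
        aBinom a 0 (k + 1)) := by
  have h := figureEight (cupLW a (k + 1)) (capLW a (k + 1)) (cupRW a (k + 1)) (capRW a (k + 1))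
    (crossW a (k + 1))
  refine Eq.trans ?_ (h.trans ?_)
  · rfl
  · rw [ptr_crossW, MonoidalLinear.whiskerLeft_smul, MonoidalCategory.whiskerLeft_id,
      Linear.smul_comp, Category.id_comp, Linear.comp_smul, circleL, smul_smul]

end Closures

/-! ### Collapse of the alternating sum to the framing factor -/

section Twist

variable {R : Type u} [CommRing R] [Algebra Kq R] (a : Rˣ)

theorem sc_inv_mul {x : Kq} (hx : x ≠ 0) (r : R) : PreHom.sc R x⁻¹ * (PreHom.sc R x * r) = r := by
  rw [← mul_assoc, ← sc_mul, inv_mul_cancel₀ hx, sc_one, one_mul]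

theorem aInt_sub (c n : ℤ) :
    PreHom.aInt a c - PreHom.sc R (q ^ (-n)) * PreHom.aInt a (c + n) =
      a * PreHom.sc R (q ^ (-c - n) * qSym n) := by
  have h0 := q_ne_zero
  have e1 : PreHom.sc R (q ^ (-n)) * PreHom.sc R (q ^ (c + n)) = PreHom.sc R (q ^ c) := by
    rw [← sc_mul, ← zpow_add₀ h0]; congr 2; ring
  have e2 : PreHom.sc R (q ^ (-c - n) * qSym n) = (PreHom.sc R (q ^ (-c)) -
      PreHom.sc R (q ^ (-n)) * PreHom.sc R (q ^ (-(c + n)))) * PreHom.sc R (q - q⁻¹)⁻¹ := by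
    have f1 : q ^ (-c - n) * q ^ n = q ^ (-c) := by
      rw [← zpow_add₀ h0, sub_add_cancel]
    have f2 : q ^ (-n) * q ^ (-(c + n)) = q ^ (-c - n) * q ^ (-n) := by
      rw [mul_comm, neg_add, ← sub_eq_add_neg]
    rw [← sc_mul, ← sc_sub, ← sc_mul, f2, ← f1, qSym, div_eq_mul_inv, ← mul_assoc, mul_sub]
  rw [e2, PreHom.aInt, PreHom.aInt, ← e1]
  ring

/-- The quantum Pascal rule at the level of integers; it splits `[k + 1]` in the recursion for
`twistSum`. -/
theorem qSym_add (m n : ℤ) : qSym (m + n) = q ^ n * qSym m + q ^ (-m) * qSym n := by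
  have h0 := q_ne_zero
  have h1 := q_sub_inv_ne_zero
  rw [qSym, qSym, qSym, neg_add, zpow_add₀ h0, zpow_add₀ h0]
  field_simp
  ring

/-- The alternating sum `∑_c (-1)^c q^{-c} [a; s + c] ⋯ [a; s + c + k - 1] / ([c]! [k - c]!)`. -/
def twistSum (k s : ℕ) : R :=
  ∑ c ∈ Finset.range (k + 1),
    PreHom.sc R ((-1) ^ c * q ^ (-(c : ℤ)) * (qSymFact c * qSymFact (k - c))⁻¹) *
      aProd a (s + c) k

/-- After multiplication by `[k + 1] = q^c [k + 1 - c] + q^{-(k + 1 - c)} [c]`, each part cancels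
one factor of the factorials. Shifting the second sum by one makes the terms share the brackets `[a;
s + c + 1] ⋯ [a; s + c + k]`, and the remaining difference `[a; s + c] - q^{-(k + 1)} [a; s + c + k
+ 1]` is a single power of `q` times `a [k + 1]`. -/
theorem twistSum_succ (k s : ℕ) :
    twistSum a (k + 1) s = a * PreHom.sc R (q ^ (-(s + k + 1 : ℤ))) * twistSum a k (s + 1) := by
  have h0 := q_ne_zero
  have hk : qSym (k + 1) ≠ 0 := qSym_ne_zero (by omega)
  suffices h : PreHom.sc R (qSym (k + 1)) * twistSum a (k + 1) s = PreHom.sc R (qSym (k + 1)) *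
      (a * PreHom.sc R (q ^ (-(s + k + 1 : ℤ))) * twistSum a k (s + 1)) by
    rw [← sc_inv_mul hk (twistSum a (k + 1) s), h, sc_inv_mul hk]
  have h1 : PreHom.sc R (qSym (k + 1)) * twistSum a (k + 1) s =
      ∑ c ∈ Finset.range (k + 2),
        PreHom.sc R ((-1) ^ c * (qSymFact c * qSymFact (k + 1 - c))⁻¹ * qSym (k + 1 - c)) *
          aProd a (s + c) (k + 1) +
      ∑ c ∈ Finset.range (k + 2),
        PreHom.sc R ((-1) ^ c * q ^ (-(k + 1 : ℤ)) * (qSymFact c * qSymFact (k + 1 - c))⁻¹ *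
          qSym c) * aProd a (s + c) (k + 1) := by
    rw [twistSum, Finset.mul_sum, ← Finset.sum_add_distrib]
    refine Finset.sum_congr rfl fun c _ => ?_
    rw [← mul_assoc, ← sc_mul, ← add_mul]
    congr 1
    rw [PreHom.sc, PreHom.sc, PreHom.sc, ← map_add]
    congr 1
    have e := qSym_add (k + 1 - c) c
    rw [sub_add_cancel] at e
    have e1 : q ^ (-(c : ℤ)) * q ^ (c : ℤ) = 1 := by
      rw [← zpow_add₀ h0, neg_add_cancel, zpow_zero]
    have e2 : q ^ (-(c : ℤ)) * q ^ (-(k + 1 - c : ℤ)) = q ^ (-(k + 1 : ℤ)) := by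
      rw [← zpow_add₀ h0]; congr 1; ring
    rw [e, ← e2]
    linear_combination ((-1) ^ c * (qSymFact c * qSymFact (k + 1 - c))⁻¹ * qSym (k + 1 - c)) * e1
  rw [h1, Finset.sum_range_succ, Finset.sum_range_succ' _ (k + 1), twistSum, Finset.mul_sum,
    Finset.mul_sum]
  -- The boundary terms, `c = k + 1` in the first sum and `c = 0` in the second, carry the factor
  -- `[0]`.
  have z : qSym 0 = 0 := by simp [qSym]
  have z1 : qSym ((k : ℤ) + 1 - (k + 1 : ℕ)) = 0 := by rw [← z]; congr 1; push_cast; ring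
  rw [z1, Nat.cast_zero, z, mul_zero, mul_zero, PreHom.sc, map_zero, zero_mul, zero_mul, add_zero,
    add_zero, ← Finset.sum_add_distrib]
  refine Finset.sum_congr rfl fun c hc => ?_
  have hc' : c ≤ k := Nat.lt_succ_iff.mp (Finset.mem_range.mp hc)
  have f1 : (qSymFact c * qSymFact (k + 1 - c))⁻¹ * qSym (k + 1 - c) =
      (qSymFact c * qSymFact (k - c))⁻¹ := by
    have e : (k : ℤ) + 1 - c = (k - c : ℕ) + 1 := by omega
    have := qSym_ne_zero (n := (k - c : ℕ) + 1) (by omega)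
    have := qSymFact_ne_zero c
    have := qSymFact_ne_zero (k - c)
    rw [e, Nat.sub_add_comm hc', qSymFact_succ]
    field_simp
  have f2 : (qSymFact (c + 1) * qSymFact (k + 1 - (c + 1)))⁻¹ * qSym (c + 1 : ℕ) =
      (qSymFact c * qSymFact (k - c))⁻¹ := by
    have := qSym_ne_zero (n := c + 1) (by omega)
    have := qSymFact_ne_zero c
    have := qSymFact_ne_zero (k - c)
    rw [Nat.add_sub_add_right, qSymFact_succ, Nat.cast_succ]
    field_simp
  rw [mul_assoc _ _ (qSym _), f1, mul_assoc _ _ (qSym _), f2, aProd_succ', aProd_succ,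
    show s + (c + 1) = s + c + 1 by ring, show s + 1 + c = s + c + 1 by ring]
  have key := aInt_sub a (s + c : ℕ) (k + 1)
  have e3 : ((s + c + 1 + k : ℕ) : ℤ) = (s + c : ℕ) + (k + 1) := by push_cast; ring
  have e4 : q ^ (-((s + c : ℕ) : ℤ) - (k + 1)) = q ^ (-(s + k + 1 : ℤ)) * q ^ (-(c : ℤ)) := by
    rw [← zpow_add₀ h0]; congr 1; push_cast; ring
  rw [e4] at key
  rw [e3, pow_succ]
  simp only [sc_mul, sc_neg, mul_neg, mul_one, neg_mul] at key ⊢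
  linear_combination (PreHom.sc R ((-1) ^ c) * PreHom.sc R ((qSymFact c * qSymFact (k - c))⁻¹) *
    aProd a (s + c + 1) k) * key

theorem twistSum_eq (k s : ℕ) :
    twistSum a k s = (a : R) ^ k * PreHom.sc R (q ^ (-(k * s + k * k : ℤ))) := by
  induction k generalizing s with
  | zero => simp [twistSum, aProd, qSymFact_zero, sc_one]
  | succ k ih =>
    have e : q ^ (-((k + 1 : ℕ) * s + (k + 1 : ℕ) * (k + 1 : ℕ) : ℤ)) =
        q ^ (-(s + k + 1 : ℤ)) * q ^ (-(k * (s + 1 : ℕ) + k * k : ℤ)) := by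
      rw [← zpow_add₀ q_ne_zero]; congr 1; push_cast; ring
    rw [twistSum_succ, ih, e, sc_mul]; ring

theorem aProd_add (s m n : ℕ) : aProd a s (m + n) = aProd a s m * aProd a (s + m) n := by
  rw [aProd, Finset.prod_range_add, aProd, aProd]
  simp only [add_assoc]

/-- With `c = k - j`, the brackets from `c` to `k - 1` and from `k` to `k + c - 1` form one run of
length `k` starting at `c`. -/
theorem sum_aBinom (k : ℕ) :
    ∑ j ∈ Finset.range (k + 1),
      PreHom.sc R ((-q) ^ j) * (aBinom a (k - j) j * aBinom a k (k - j)) =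
      PreHom.sc R ((-q) ^ k) * twistSum a k 0 := by
  rw [← Finset.sum_range_reflect, twistSum, Finset.mul_sum]
  refine Finset.sum_congr rfl fun c hc => ?_
  have hc' : c ≤ k := Nat.lt_succ_iff.mp (Finset.mem_range.mp hc)
  obtain ⟨d, rfl⟩ := Nat.exists_eq_add_of_le hc'
  have e1 : c + d + 1 - 1 - c = d := by omega
  have e2 : c + d - d = c := by omega
  have e3 : c + d - c = d := by omega
  have e4 : (-q) ^ (c + d) * ((-1) ^ c * q ^ (-(c : ℤ))) = (-q) ^ d := by
    have : q ^ c * q ^ (-(c : ℤ)) = 1 := by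
      rw [zpow_neg, zpow_natCast]; exact mul_inv_cancel₀ (pow_ne_zero _ q_ne_zero)
    have h1 : ((-1 : Kq) ^ c) * (-1) ^ c = 1 := by rw [← mul_pow]; simp
    rw [pow_add, neg_pow q c]
    linear_combination ((-q) ^ d * (-1) ^ c * (-1) ^ c) * this + (-q) ^ d * h1
  rw [e1, e2, e3, zero_add, add_comm c d, aProd_add a c d c] at *
  rw [aBinom, aBinom, mul_inv, ← e4, add_comm c d]
  simp only [sc_mul]
  ring

/-- The coloured HOMFLY-PT polynomial of the once stabilized unknot. -/
def unknotValue (k : ℕ) : R :=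
  PreHom.sc R (q ^ (k - 2 * (k * k) : ℤ)) * (a : R) ^ k * aBinom a 0 k

theorem hasLinkValue_unknotValue {k : ℕ} (hk : 1 ≤ k) :
    HasLinkValue a (stabilizedUnknot k) (unknotValue a k) := by
  obtain ⟨k, rfl⟩ := Nat.exists_eq_add_of_le' hk
  convert hasLinkValue_stabilizedUnknot (a := a) k using 1
  generalize k + 1 = k
  rw [sum_aBinom, twistSum_eq, unknotValue]
  have e : q ^ (k - 2 * (k * k) : ℤ) =
      (-q) ^ (-(k * k : ℤ)) * ((-q) ^ k * q ^ (-(k * (0 : ℕ) + k * k : ℤ))) := by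
    have h1 : (-q) ^ (-(k * k : ℤ)) * (-q) ^ k = q ^ (k - k * k : ℤ) := by
      rw [← zpow_natCast, ← zpow_add₀ (neg_ne_zero.mpr q_ne_zero)]
      -- The sign of `(-q) ^ (k - k²)` disappears since `k (k - 1)` is even.
      have : Even (-(k * k : ℤ) + k) := by
        have := Int.even_mul_succ_self (k - 1 : ℤ)
        have e : -(k * k : ℤ) + k = -((k - 1) * (k - 1 + 1)) := by ring
        rw [e]; exact this.neg
      rw [this.neg_zpow]; congr 1; ring
    rw [← mul_assoc ((-q) ^ _), h1, ← zpow_add₀ q_ne_zero]; congr 1; push_cast; ring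
  rw [e, sc_mul, sc_mul]
  ring

end Twist

/-! ### Translation of `q`-rationals by integers -/

section Rational

theorem qInt_succ (n : ℤ) : qInt n = q ^ 2 * qInt (n - 1) + 1 := by
  have h0 := q_ne_zero
  have h1 := q_sq_sub_one_ne_zero
  have e : q ^ (2 * n) = q ^ 2 * q ^ (2 * (n - 1)) := by
    rw [← zpow_natCast, ← zpow_add₀ h0]; congr 1; push_cast; ring
  rw [qInt, qInt, e]
  field_simp
  ring

theorem qCF_cons_succ (n b : ℤ) (l : List ℤ) :
    qCF (n :: b :: l) = q ^ 2 * qCF ((n - 1) :: b :: l) + 1 := by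
  have e : q ^ (2 * n) = q ^ 2 * q ^ (2 * (n - 1)) := by
    rw [← zpow_natCast, ← zpow_add₀ q_ne_zero]; congr 1; push_cast; ring
  cases l with
  | nil => rw [qCF, qCF, qInt_succ n, e]; ring
  | cons c l => rw [qCF, qCF, qInt_succ n, e]; ring

/-- Passing from `x` to `x - 1` lowers the first entry of the continued fraction by one and keeps
all others, and the deformed fraction is affine in `{a₁}` and `q ^ (2 a₁)`. -/
theorem qRat_eq (x : ℚ) : qRat x = q ^ 2 * qRat (x - 1) + 1 := by
  have h : ∃ b l, evenCF x = (⌈x⌉ - 1) :: b :: l ∧ evenCF (x - 1) = (⌈x⌉ - 1 - 1) :: b :: l := by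
    have e : (x - 1 - ((⌈x⌉ - 1 - 1 : ℤ) : ℚ))⁻¹ = (x - ((⌈x⌉ - 1 : ℤ) : ℚ))⁻¹ := by
      push_cast; ring
    rw [evenCF.eq_1 x, evenCF.eq_1 (x - 1)]
    simp only [Int.ceil_sub_one, e]
    split_ifs
    · exact ⟨_, _, rfl, rfl⟩
    · exact ⟨_, _, rfl, rfl⟩
  obtain ⟨b, l, h1, h2⟩ := h
  rw [qRat, qRat, h1, h2, qCF_cons_succ]

/-- The affine map `y ↦ q² y + 1` becomes multiplication by `q²` in the coordinate `(q² - 1) y + 1`.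
-/
theorem qRat_sub_natCast (x : ℚ) (i : ℕ) :
    (q ^ 2 - 1) * qRat (x - i) + 1 = q ^ (-2 * i : ℤ) * (q ^ 2 * qDelta x) := by
  induction i with
  | zero =>
    have := qRat_eq x
    simp only [Nat.cast_zero, sub_zero, mul_zero, zpow_zero, one_mul, qDelta]
    linear_combination -this
  | succ i ih =>
    have h := qRat_eq (x - i)
    have e : q ^ (-2 * i : ℤ) = q ^ (-2 * (i + 1 : ℕ) : ℤ) * q ^ 2 := by
      rw [← zpow_natCast, ← zpow_add₀ q_ne_zero]; congr 1; push_cast; ring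
    rw [show x - (i + 1 : ℕ) = x - i - 1 by push_cast; ring]
    refine mul_left_cancel₀ (pow_ne_zero 2 q_ne_zero) ?_
    rw [e] at ih
    linear_combination ih - (q ^ 2 - 1) * h

end Rational

/-! ### Specialization at `a = q ν_x δ_x` -/

section Specialization

variable {R : Type u} [CommRing R] [Algebra Kq R]

/-- Multiplying the bracket by `a` leaves only `a² = q² δ_x`, so `ν` drops out and the result lies
in the image of `ℚ(q)`. -/
theorem aSpec_mul_aInt {x : ℚ} {ν : R} (hν : ν ^ 2 = algebraMap Kq R (qDelta x)⁻¹) (i : ℕ) :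
    (aSpec x ν hν : R) * PreHom.aInt (aSpec x ν hν) i =
      PreHom.sc R (q ^ (i + 1 : ℤ) * qRat (x - i)) := by
  have h0 := q_ne_zero
  have h1 := q_sq_sub_one_ne_zero
  have hsq : (aSpec x ν hν : R) * (aSpec x ν hν : R) = PreHom.sc R (q ^ 2 * qDelta x) := by
    have h := sq_mul_qDelta hν
    simp only [aSpec, PreHom.sc, map_mul, map_pow]
    linear_combination (algebraMap Kq R q ^ 2 * algebraMap Kq R (qDelta x)) * h
  have hinv := (aSpec x ν hν).mul_inv
  have e : q ^ (i + 1 : ℤ) * qRat (x - i) =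
      (q ^ 2 * qDelta x * q ^ (-i : ℤ) - q ^ (i : ℤ)) * (q - q⁻¹)⁻¹ := by
    have h := qRat_sub_natCast x i
    have e1 : q - q⁻¹ = (q ^ 2 - 1) / q := by field_simp
    have e2 : q ^ (-2 * i : ℤ) = q ^ (-i : ℤ) * q ^ (-i : ℤ) := by
      rw [← zpow_add₀ h0]; congr 1; ring
    have e3 : q ^ (i : ℤ) * q ^ (-i : ℤ) = 1 := by
      rw [← zpow_add₀ h0, add_neg_cancel, zpow_zero]
    rw [e1, inv_div, ← mul_div_assoc, eq_div_iff h1, zpow_add_one₀ h0]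
    rw [e2] at h
    linear_combination (q ^ (i : ℤ) * q) * h + (q ^ (-i : ℤ) * q ^ 2 * qDelta x * q) * e3
  rw [e, sc_mul, sc_sub, sc_mul _ (q ^ (-i : ℤ)), ← hsq, PreHom.aInt]
  linear_combination (-PreHom.sc R (q ^ (i : ℤ)) * PreHom.sc R (q - q⁻¹)⁻¹) * hinv

theorem unknotValue_aSpec {x : ℚ} {ν : R} (hν : ν ^ 2 = algebraMap Kq R (qDelta x)⁻¹) (k : ℕ) :
    unknotValue (aSpec x ν hν) k =
      algebraMap Kq R (q ^ (-(k * (k - 1) : ℤ)) * qBinom x k) := by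
  have h0 := q_ne_zero
  induction k with
  | zero => simp [unknotValue, aBinom_zero, qBinom, sc_one]
  | succ k ih =>
    have e1 : unknotValue (aSpec x ν hν) (k + 1) = unknotValue (aSpec x ν hν) k *
        PreHom.sc R (q ^ (-(4 * k + 1) : ℤ) * (qSym (k + 1))⁻¹) *
          ((aSpec x ν hν : R) * PreHom.aInt (aSpec x ν hν) k) := by
      have e : q ^ ((k + 1 : ℕ) - 2 * ((k + 1 : ℕ) * (k + 1 : ℕ)) : ℤ) =
          q ^ (k - 2 * (k * k) : ℤ) * q ^ (-(4 * k + 1) : ℤ) := by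
        rw [← zpow_add₀ h0]; congr 1; push_cast; ring
      rw [unknotValue, unknotValue, aBinom_succ, e, sc_mul, sc_mul, zero_add]; ring
    rw [e1, ih, aSpec_mul_aInt, PreHom.sc, ← map_mul, PreHom.sc, ← map_mul]
    congr 1
    have e2 : qBinom x (k + 1) = qBinom x k * (qRat (x - k) * (qInt (k + 1))⁻¹) := by
      rw [qBinom, qBinom, Finset.prod_range_succ, Finset.prod_range_succ, mul_div_mul_comm,
        div_eq_mul_inv (qRat _)]
    -- The factor `q ^ ((k + 1) - 1)` converts `[k + 1]` to `{k + 1}`.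
    have e3 : q ^ (-((k + 1 : ℕ) * ((k + 1 : ℕ) - 1) : ℤ)) * (q ^ ((k + 1 : ℤ) - 1))⁻¹ =
        q ^ (-(k * (k - 1) : ℤ)) * (q ^ (-(4 * k + 1) : ℤ) * q ^ (k + 1 : ℤ)) := by
      rw [← zpow_neg, ← zpow_add₀ h0, ← zpow_add₀ h0, ← zpow_add₀ h0]
      congr 1; push_cast; ring
    rw [e2, qInt_eq, mul_inv]
    linear_combination (-(qBinom x k * qRat (x - k) * (qSym (k + 1))⁻¹)) * e3

/-- `unknotValue` is one expression in `a`, `a⁻¹` and scalars from `ℚ(q)` over every base, hence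
compatible with ring homomorphisms. -/
theorem eval₂_unknotValue (b : Rˣ) (k : ℕ) :
    LaurentPolynomial.eval₂ (algebraMap Kq R) b (unknotValue aVar k) = unknotValue b k := by
  have hsc (c : Kq) : LaurentPolynomial.eval₂ (algebraMap Kq R) b (PreHom.sc Ka c) =
      PreHom.sc R c := LaurentPolynomial.eval₂_C _ _ _
  have ha : LaurentPolynomial.eval₂ (algebraMap Kq R) b (aVar : Ka) = b := by
    simp [aVar]
  have ha' : LaurentPolynomial.eval₂ (algebraMap Kq R) b ((aVar⁻¹ : Kaˣ) : Ka) = (b⁻¹ : Rˣ) := by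
    rw [show ((aVar⁻¹ : Kaˣ) : Ka) = LaurentPolynomial.T (-1) from rfl]; simp
  simp only [unknotValue, aBinom, aProd, PreHom.aInt, map_mul, map_pow, map_prod, map_sub, hsc,
    ha, ha']

theorem isXInvariant_stabilizedUnknot {x : ℚ} {ν : R}
    (hν : ν ^ 2 = algebraMap Kq R (qDelta x)⁻¹) {k : ℕ} (hk : 1 ≤ k) :
    IsXInvariant x ν hν (stabilizedUnknot k)
      (algebraMap Kq R (q ^ (-(k * (k - 1) : ℤ)) * qBinom x k)) :=
  ⟨⟨unknotValue aVar k, hasLinkValue_unknotValue aVar hk,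
      (eval₂_unknotValue _ k).trans (unknotValue_aSpec hν k)⟩,
    unknotValue_aSpec hν k ▸ hasLinkValue_unknotValue _ hk⟩

end Specialization

end

end QWeb

theorem mainTheorem3 {R : Type*} [CommRing R] [Algebra QWeb.Kq R] (x : ℚ) (ν : R)
    (hν : ν ^ 2 = algebraMap QWeb.Kq R (QWeb.qDelta x)⁻¹) :
    QWeb.IsXInvariant x ν hν (QWeb.stabilizedUnknot 1) (algebraMap QWeb.Kq R (QWeb.qRat x)) ∧
    ∀ k : ℕ, 1 ≤ k →
      QWeb.IsXInvariant x ν hν (QWeb.stabilizedUnknot k)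
        (algebraMap QWeb.Kq R (QWeb.q ^ (-(k * (k - 1) : ℤ)) * QWeb.qBinom x k)) := by
  refine ⟨?_, fun k hk => QWeb.isXInvariant_stabilizedUnknot hν hk⟩
  have h := QWeb.isXInvariant_stabilizedUnknot hν le_rfl
  have e : QWeb.q ^ (-((1 : ℕ) * ((1 : ℕ) - 1) : ℤ)) * QWeb.qBinom x 1 = QWeb.qRat x := by
    simp [QWeb.qBinom, QWeb.qInt_one]
  rwa [e] at h
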